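/- **Setting.** A *Lefschetz complex* over $\mathbb Z_2$ is a finite set $X$ of cells with maps $\dim:X\to\mathbb N$ and $D:X\times X\to\mathbb Z_2$ such that $D(x,y)\neq0$ implies $\dim x+1=\dim y$, and $\sum_{z}D(x,z)D(z,y)=0$ for all $x,y$. A *discrete Morse function* (dMf) on $X$ is a map $h:X\to\mathbb R$ such that $D(x,y)=1$ implies $h(x)\le h(y)$; for $x\ne y$, $h(x)=h(y)$ implies $D(x,y)=1$ or $D(y,x)=1$; and $|h^{-1}(a)|\le2$ for all $a\in\mathbb R$. The *$h$-order* is the total order with $x<_hy$ iff $h(x)<h(y)$, or $h(x)=h(y)$ and $\dim x<\dim y$. *Pairs and relations.* Lazy reduction of a matrix with ordered rows and columns starts with $R=D$, $U=I$ and treats the columns $y$ from left to right: while $R[:,y]\ne0$ and a preceding column $x$ has the same lowest nonzero row, it puts $R[:,y]\leftarrow R[:,y]+R[:,x]$ and $U[x,:]\leftarrow U[x,:]+U[y,:]$. Let $R,U$ result from $D$, with rows and columns in $h$-order, and $R^\perp,U^\perp$ from the transpose of $D$, with rows and columns in reversed $h$-order. A pair $\alpha=(b\alpha,d\alpha)$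 is in $\mathrm{bd}(h)$ (a birth-death pair) if $b\alpha$ is the lowest nonzero row of $R[:,d\alpha]$; its dimension is $\dim b\alpha$; it is *off-diagonal* if $h(b\alpha)<h(d\alpha)$. For distinct cells $x,y$ of equal dimension write $x\xrightarrow{\times}y$ if $U[x,y]=1$ and $x\xrightarrow{\circ}y$ if $U^\perp[x,y]=1$. For pairs, $\beta\xrightarrow{\times}\alpha$ means that $d\beta\xrightarrow{\times}c$ for a component $c$ of $\alpha$, and $\beta\xrightarrow{\circ}\alpha$ that $b\beta\xrightarrow{\circ}c$ for a component $c$ of $\alpha$. *Vector field.* $\mathcal V_h$ is the partition of $X$ into the nonempty level sets of $h$; its singletons are the *critical cells*. Its digraph has an arc $x\to y$ if either $D(x,y)=1$ and $\{x,y\}\in\mathcal V_h$, or $D(y,x)=1$ and $\{x,y\}\notin\mathcal V_h$. Write $x\rightsquigarrow y$ if there is a directed path with at least one arc from $x$ to $y$. *Forbidden regions.* For an off-diagonal pair $\alpha$ of dimension $n$, the forbidden region for $d\alpha$ is the union in $[-\infty,\infty]^2$ of the sets $[-\infty,h(b\beta)]\times[-\infty,h(d\beta)]$ over the $n$-dimensional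 off-diagonal pairs $\beta\xrightarrow{\times}\alpha$ and of the sets $[-\infty,h(x)]^2$ over the critical $x$ with $d\alpha\rightsquigarrow x$. The forbidden region for $b\alpha$ is the union of the sets $[h(b\beta),\infty]\times[h(d\beta),\infty]$ over the $n$-dimensional off-diagonal pairs $\beta\xrightarrow{\circ}\alpha$ and of the sets $[h(y),\infty]^2$ over the critical $y$ with $y\rightsquigarrow b\alpha$. *Allowed moves.* Let $\alpha$ be an off-diagonal pair of $h$. A dMf $h'$ is an *allowed move* of $\alpha$ with respect to $h$ if $\mathcal V_{h'}=\mathcal V_h$, $\mathrm{bd}(h')=\mathrm{bd}(h)$, and for some component $c$ of $\alpha$: $h'=h$ on all critical cells except $c$; $h'(c)>h(c)$ if $c=b\alpha$ and $h'(c)<h(c)$ if $c=d\alpha$; and the $h$-order and the $h'$-order on the critical cells differ by at most one transposition (of two adjacent cells). **Theorem.** Let $h$ be a discrete Morse function on a Lefschetz complex $X$ and let $\alpha$ be an off-diagonal birth-death pair of $h$ whose two forbidden regions (for $b\alpha$ and for $d\alpha$) are disjoint. Then for every $\varepsilon>0$ there is a finite sequence $h=h_1,h_2,\dots,h_n$ ($n\ge1$)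 of discrete Morse functions on $X$ such that each $h_{i+1}$ is an allowed move of $\alpha$ with respect to $h_i$ (so $\mathrm{bd}(h_i)=\mathrm{bd}(h)$ and $\mathcal V_{h_i}=\mathcal V_h$ for all $i$), and $0<h_n(d\alpha)-h_n(b\alpha)<\varepsilon$. -/

import Mathlib

/-- A Lefschetz complex on the finite set of cells `X`, with boundary coefficients in `ZMod 2`.
`bd x y` is the coefficient of `x` in the boundary of `y`. -/
structure LefschetzComplex (X : Type*) [Fintype X] where
  dim : X → ℕ
  bd : X → X → ZMod 2
  dim_of_bd : ∀ x y, bd x y ≠ 0 → dim x + 1 = dim y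
  bd_bd : ∀ x y, ∑ z, bd x z * bd z y = 0

/-! ### Lazy reduction of a matrix over `ZMod 2`

Rows and columns are indexed by the same finite linearly ordered set `ι`, the smallest index being
the top row and the leftmost column.  Applied to the total boundary matrix of a complex
this reduces the matrices of all degrees at once: two nonzero columns with the same low belong to
cells of the same dimension, so cells of different dimensions never interact. -/

section LazyReduction

variable {ι : Type*} [Fintype ι] [LinearOrder ι]

/-- The index of the lowest (i.e. largest) row with a nonzero entry, `⊥` for the zero column. -/
def low (c : ι → ZMod 2) : WithBot ι := (Finset.univ.filter fun i => c i ≠ 0).max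

/-- The two matrices kept by the algorithm. -/
structure ReductionState (ι : Type*) where
  R : Matrix ι ι (ZMod 2)
  U : Matrix ι ι (ZMod 2)

/-- The preceding columns that have the same low as the nonzero column `y`
(in the course of the algorithm there is never more than one). -/
def reducers (y : ι) (s : ReductionState ι) : Finset ι :=
  Finset.univ.filter fun x =>
    x < y ∧ (fun i => s.R i y) ≠ 0 ∧ low (fun i => s.R i x) = low (fun i => s.R i y)

/-- One pass through the inner loop: `R[:,y] ← R[:,y] + R[:,x]` and `U[x,:] ← U[x,:] + U[y,:]`,
where `x` is a preceding column with the same low; nothing happens if there is none. -/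
def lazyStep (y : ι) (s : ReductionState ι) : ReductionState ι :=
  if hx : (reducers y s).Nonempty then
    let x := (reducers y s).min' hx
    { R := fun i j => if j = y then s.R i y + s.R i x else s.R i j
      U := fun i j => if i = x then s.U x j + s.U y j else s.U i j }
  else s

/-- The inner loop for column `y`.  Every effective pass moves the low of the column strictly up,
so the loop has stopped after at most `Fintype.card ι` passes. -/
def reduceColumn (s : ReductionState ι) (y : ι) : ReductionState ι :=
  (lazyStep y)^[Fintype.card ι] s

/-- The lazy reduction: start from `R = D`, `U = 1`, and treat the columns from left to right. -/
def lazyReduction (D : Matrix ι ι (ZMod 2)) : ReductionState ι :=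
  (Finset.univ.sort (fun a b : ι => a ≤ b)).foldl reduceColumn { R := D, U := 1 }

end LazyReduction

/-- A discrete Morse function on a Lefschetz complex. -/
structure DiscreteMorseFunction {X : Type*} [Fintype X] (K : LefschetzComplex X) where
  toFun : X → ℝ
  mono : ∀ x y, K.bd x y = 1 → toFun x ≤ toFun y
  pairing : ∀ x y, x ≠ y → toFun x = toFun y → K.bd x y = 1 ∨ K.bd y x = 1
  almost_injective : ∀ a : ℝ, {x | toFun x = a}.ncard ≤ 2

namespace DiscreteMorseFunction

variable {X : Type*} [Fintype X] {K : LefschetzComplex X}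

instance : CoeFun (DiscreteMorseFunction K) (fun _ => X → ℝ) := ⟨toFun⟩

/-- The strict `h`-order on the cells. -/
def lt (h : DiscreteMorseFunction K) (x y : X) : Prop :=
  h x < h y ∨ (h x = h y ∧ K.dim x < K.dim y)

theorem key_injective (h : DiscreteMorseFunction K) :
    Function.Injective (fun x => toLex (h x, K.dim x)) := by
  intro x y hxy
  have h1 : h x = h y ∧ K.dim x = K.dim y := by simpa using hxy
  by_contra hne
  rcases h.pairing x y hne h1.1 with hd | hd
  · have := K.dim_of_bd x y (by rw [hd]; exact one_ne_zero)
    omega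
  · have := K.dim_of_bd y x (by rw [hd]; exact one_ne_zero)
    omega

/-- The `h`-order as a linear order on the cells. -/
noncomputable abbrev order (h : DiscreteMorseFunction K) : LinearOrder X :=
  LinearOrder.lift' (fun x => toLex (h x, K.dim x)) h.key_injective

theorem order_lt_iff (h : DiscreteMorseFunction K) (x y : X) :
    h.order.lt x y ↔ h.lt x y := by
  change toLex (h x, K.dim x) < toLex (h y, K.dim y) ↔ _
  rw [Prod.Lex.toLex_lt_toLex]
  rfl

/-- The lazy reduction of the boundary matrix, rows and columns in the `h`-order. -/
noncomputable def homReduction (h : DiscreteMorseFunction K) : ReductionState X :=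
  letI := h.order
  lazyReduction (ι := X) (fun i j => K.bd i j)

/-- The lazy reduction of the coboundary matrix, rows and columns in the reversed `h`-order. -/
noncomputable def cohomReduction (h : DiscreteMorseFunction K) : ReductionState Xᵒᵈ :=
  letI := h.order
  lazyReduction (ι := Xᵒᵈ) (fun i j => K.bd (OrderDual.ofDual j) (OrderDual.ofDual i))

/-- The birth-death pairs `(b, d)`: `b` is the low of the column of `d` in the reduced matrix. -/
def birthDeath (h : DiscreteMorseFunction K) : Set (X × X) :=
  letI := h.order
  {p | low (fun i => h.homReduction.R i p.2) = (p.1 : WithBot X)}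

/-- The off-diagonal birth-death pairs. -/
def offDiagonal (h : DiscreteMorseFunction K) : Set (X × X) :=
  {p | p ∈ h.birthDeath ∧ h p.1 < h p.2}

/-- Homological relation between two distinct cells of the same dimension. -/
def HomRel (h : DiscreteMorseFunction K) (x y : X) : Prop :=
  K.dim x = K.dim y ∧ x ≠ y ∧ h.homReduction.U x y = 1

/-- Cohomological relation between two distinct cells of the same dimension. -/
def CohomRel (h : DiscreteMorseFunction K) (x y : X) : Prop :=
  K.dim x = K.dim y ∧ x ≠ y ∧ h.cohomReduction.U (OrderDual.toDual x) (OrderDual.toDual y) = 1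

/-- Homological relation `β → α` between pairs. -/
def PairHomRel (h : DiscreteMorseFunction K) (β α : X × X) : Prop :=
  h.HomRel β.2 α.1 ∨ h.HomRel β.2 α.2

/-- Cohomological relation `β → α` between pairs. -/
def PairCohomRel (h : DiscreteMorseFunction K) (β α : X × X) : Prop :=
  h.CohomRel β.1 α.1 ∨ h.CohomRel β.1 α.2

/-- The vector field of `h`: the partition of the cells into the nonempty level sets. -/
def vectorField (h : DiscreteMorseFunction K) : Set (Set X) :=
  {A | A.Nonempty ∧ ∃ a : ℝ, A = {x | h x = a}}

end DiscreteMorseFunction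

section VectorFields

variable {X : Type*} [Fintype X]

/-- The critical cells of a vector field: the cells that form a singleton class. -/
def critCells (V : Set (Set X)) : Set X := {x | {x} ∈ V}

/-- The arcs of the digraph of a vector field: explicit arcs go from the facet to the cofacet of
a vector, implicit arcs go from a cell to a facet with which it does not form a vector. -/
def Arc (K : LefschetzComplex X) (V : Set (Set X)) (x y : X) : Prop :=
  (K.bd x y = 1 ∧ {x, y} ∈ V) ∨ (K.bd y x = 1 ∧ {x, y} ∉ V)

/-- There is a path (with at least one arc) from `x` to `y`. -/
def HasPath (K : LefschetzComplex X) (V : Set (Set X)) (x y : X) : Prop :=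
  Relation.TransGen (Arc K V) x y

end VectorFields

namespace DiscreteMorseFunction

variable {X : Type*} [Fintype X] {K : LefschetzComplex X}

/-- The forbidden region for the death cell of `α`. -/
def deathForbidden (h : DiscreteMorseFunction K) (α : X × X) : Set (EReal × EReal) :=
  (⋃ β ∈ {β | β ∈ h.offDiagonal ∧ K.dim β.1 = K.dim α.1 ∧ h.PairHomRel β α},
      Set.Icc ⊥ (h β.1 : EReal) ×ˢ Set.Icc ⊥ (h β.2 : EReal)) ∪
  (⋃ x ∈ {x | x ∈ critCells h.vectorField ∧ HasPath K h.vectorField α.2 x},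
      Set.Icc ⊥ (h x : EReal) ×ˢ Set.Icc ⊥ (h x : EReal))

/-- The forbidden region for the birth cell of `α`. -/
def birthForbidden (h : DiscreteMorseFunction K) (α : X × X) : Set (EReal × EReal) :=
  (⋃ β ∈ {β | β ∈ h.offDiagonal ∧ K.dim β.1 = K.dim α.1 ∧ h.PairCohomRel β α},
      Set.Icc (h β.1 : EReal) ⊤ ×ˢ Set.Icc (h β.2 : EReal) ⊤) ∪
  (⋃ y ∈ {y | y ∈ critCells h.vectorField ∧ HasPath K h.vectorField y α.1},
      Set.Icc (h y : EReal) ⊤ ×ˢ Set.Icc (h y : EReal) ⊤)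

/-- On the set `C` the orders of `h` and `h'` differ by a single transposition at most: there is
one pair of cells such that all other pairs are ordered in the same way.  (By transitivity, a pair
whose order is reversed is then adjacent in both orders.) -/
def AtMostOneTransposition (h h' : DiscreteMorseFunction K) (C : Set X) : Prop :=
  ∃ a b : X, ∀ x ∈ C, ∀ y ∈ C, ¬ ((x = a ∧ y = b) ∨ (x = b ∧ y = a)) →
    (h.lt x y ↔ h'.lt x y)

/-- `h'` is a pre-allowed move of the off-diagonal pair `α` of `h` which moves the component `c`
of `α`. -/
structure IsPreAllowedMove (h : DiscreteMorseFunction K) (α : X × X) (c : X)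
    (h' : DiscreteMorseFunction K) : Prop where
  mem : α ∈ h.offDiagonal
  component : c = α.1 ∨ c = α.2
  vectorField_eq : h.vectorField = h'.vectorField
  eq_on_crit : ∀ x ∈ critCells h.vectorField, x ≠ c → h x = h' x
  birth_increases : c = α.1 → h c < h' c
  death_decreases : c = α.2 → h' c < h c
  transposition : AtMostOneTransposition h h' (critCells h.vectorField)

/-- `h'` is an allowed move of `α`: a pre-allowed move that keeps all birth-death pairs. -/
def IsAllowedMove (h : DiscreteMorseFunction K) (α : X × X) (h' : DiscreteMorseFunction K) :
    Prop :=
  (∃ c, IsPreAllowedMove h α c h') ∧ h.birthDeath = h'.birthDeath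

end DiscreteMorseFunction

/-! Write α = (s, t). The two components are moved towards each other, past one critical cell at a
time. Such a move can fail in two ways: a path forbids the new order, or the exchange changes the
pairing. Both failures leave a trace in a forbidden region of the original function `h`.

Pairs are first freed from the algorithm. The cell b is paired with d iff ∂d lies in C(≤ b) + ∂C(<
d) but not in C(< b) + ∂C(< d), where C denotes chains (`IsPersistencePair`). This form is self-dual
(`IsPersistencePair.dual`), so every statement about deaths gives one about births, applied to -h on
the dual complex. Vectors are pairs on the diagonal. For critical b and d they can be eliminated:
adding all upper cells of vectors and their boundaries, whatever their height, does not affect the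
two conditions (`mem_sup_iff_mem_morseSum`). Hence the pairs depend only on the vector field and the
order of the critical cells, and the values of the other cells may be chosen at will. Values on
critical cells that decrease along paths extend to a discrete Morse function with the same vector
field (`exists_of_values`).

Let x be the critical cell just below t. Moving t below x preserves all pairs unless x is the death
of some b with s < b and ∂t is not in C(< b) + ∂C(< x) modulo the vectors
(`DeathSwap.birthDeath_eq`). In that case the decomposition of ∂t into reduced columns contains the
column of an off-diagonal pair (b', x') with b' ≥ b and x' ≥ x (`exists_related_pair`), so the death
region contains the lower left quadrant of (h b, h x). A path from t to x puts that of (h x, h x)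
there. Dually, a blocked move of s past the next critical cell y puts an upper right quadrant with
corner (h y, h u) into the birth region, for some u between the components.

If both moves are blocked, let (h w, h x) be the death corner. Since y is the lowest and x the
highest critical cell in between, h y ≤ h w and h u ≤ h x, so (h w, h x) lies in both regions,
against disjointness (`Contracts.exists_step`). Thus some move is always possible until no critical
cell is left in between; then t can be lowered arbitrarily close to s (`exists_shrink`). The regions
of `h` suffice throughout, because a cell still between s and t has been passed by neither
(`Contracts.lt_iff_left`). -/

/-! ### Invariants of the lazy reduction -/

/-- `b` is the index of the last nonzero entry of `c`, with respect to the order `lt`. -/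
def IsLow {X : Type*} (lt : X → X → Prop) (c : X → ZMod 2) (b : X) : Prop :=
  c b ≠ 0 ∧ ∀ z, lt b z → c z = 0

/-- The relation of a lazy reduction `(R, U)` to the matrix `D` it starts from. -/
structure IsLazyReduced {X : Type*} [Fintype X] (lt : X → X → Prop) (D R U : X → X → ZMod 2) :
    Prop where
  decomp : ∀ t i, D i t = ∑ x, U x t * R i x
  diag : ∀ t, U t t = 1
  lower : ∀ x t, x ≠ t → U x t ≠ 0 →
    lt x t ∧ ∃ b, IsLow lt (fun i => R i x) b ∧ ∀ z, z = b ∨ lt b z → R z t = 0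
  distinct : ∀ x y b, IsLow lt (fun i => R i x) b → IsLow lt (fun i => R i y) b → x = y
  homogeneous : ∀ dim : X → ℕ, (∀ i j, D i j ≠ 0 → dim i + 1 = dim j) →
    (∀ i j, R i j ≠ 0 → dim i + 1 = dim j) ∧ ∀ i j, U i j ≠ 0 → dim i = dim j

theorem ZMod.two_eq_one_of_ne_zero {a : ZMod 2} (ha : a ≠ 0) : a = 1 := by
  revert a; decide

section LazyReductionInvariants

variable {ι : Type*} [Fintype ι] [LinearOrder ι]

theorem low_eq_coe_iff (c : ι → ZMod 2) (b : ι) :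
    low c = (b : WithBot ι) ↔ IsLow (fun x y => x < y) c b := by
  unfold low IsLow
  constructor
  · intro h
    refine ⟨by simpa using Finset.mem_of_max h, fun z hz => ?_⟩
    by_contra hc
    exact absurd (Finset.le_max_of_eq (by simpa using hc) h) (not_le.2 hz)
  · rintro ⟨h1, h2⟩
    refine le_antisymm (Finset.max_le fun z hz => ?_) (Finset.le_max (by simpa using h1))
    by_contra hlt
    exact (by simpa using hz : c z ≠ 0) (h2 z (by simpa using hlt))

theorem low_eq_bot_iff (c : ι → ZMod 2) : low c = ⊥ ↔ c = 0 := by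
  unfold low
  rw [Finset.max_eq_bot, Finset.filter_eq_empty_iff]
  simp [funext_iff]

theorem le_low {c : ι → ZMod 2} {i : ι} (h : c i ≠ 0) : (i : WithBot ι) ≤ low c :=
  Finset.le_max (by simpa using h)

theorem exists_isLow {c : ι → ZMod 2} (h : c ≠ 0) :
    ∃ b : ι, low c = b ∧ IsLow (fun x y => x < y) c b := by
  obtain ⟨b, hb⟩ := WithBot.ne_bot_iff_exists.1 (mt (low_eq_bot_iff c).1 h)
  exact ⟨b, hb.symm, (low_eq_coe_iff c b).1 hb.symm⟩

/-- Over `ZMod 2` the two lowest entries are both 1 and cancel. -/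
theorem low_add_lt {c c' : ι → ZMod 2} (h : c ≠ 0) (hc : low c' = low c) :
    low (fun i => c i + c' i) < low c := by
  obtain ⟨b, hb, h1⟩ := exists_isLow h
  have h2 := (low_eq_coe_iff c' b).1 (hc.trans hb)
  by_cases h0 : (fun i => c i + c' i) = 0
  · rw [(low_eq_bot_iff _).2 h0, hb]; exact WithBot.bot_lt_coe b
  obtain ⟨a, ha, h3⟩ := exists_isLow h0
  rw [ha, hb, WithBot.coe_lt_coe]
  rcases lt_trichotomy a b with h | h | h
  · exact h
  · refine absurd ?_ h3.1
    subst h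
    change c a + c' a = 0
    rw [ZMod.two_eq_one_of_ne_zero h1.1, ZMod.two_eq_one_of_ne_zero h2.1]; decide
  · refine absurd ?_ h3.1
    change c a + c' a = 0
    rw [h1.2 a h, h2.2 a h, add_zero]

/-- The invariants of the reduction when the columns satisfying `P` are finished. -/
structure ReductionInvariant (D : Matrix ι ι (ZMod 2)) (P : ι → Prop) (s : ReductionState ι) :
    Prop where
  decomp : ∀ t i, D i t = ∑ x, s.U x t * s.R i x
  diag : ∀ t, s.U t t = 1
  lower : ∀ x t, x ≠ t → s.U x t ≠ 0 → x < t ∧ P x ∧ (fun i => s.R i x) ≠ 0 ∧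
    low (fun i => s.R i t) < low (fun i => s.R i x)
  distinct : ∀ x y, P x → P y → (fun i => s.R i x) ≠ 0 →
    low (fun i => s.R i x) = low (fun i => s.R i y) → x = y

theorem mem_reducers {x y : ι} {s : ReductionState ι} :
    x ∈ reducers y s ↔ x < y ∧ (fun i => s.R i y) ≠ 0 ∧
      low (fun i => s.R i x) = low (fun i => s.R i y) := by
  simp [reducers]

theorem lazyStep_of_nonempty {y : ι} {s : ReductionState ι} (h : (reducers y s).Nonempty) :
    ∃ x ∈ reducers y s, lazyStep y s =
      { R := fun i j => if j = y then s.R i y + s.R i x else s.R i j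
        U := fun i j => if i = x then s.U x j + s.U y j else s.U i j } := by
  refine ⟨_, Finset.min'_mem _ h, ?_⟩
  rw [lazyStep, dif_pos h]

theorem lazyStep_of_not_nonempty {y : ι} {s : ReductionState ι} (h : ¬ (reducers y s).Nonempty) :
    lazyStep y s = s := by
  rw [lazyStep, dif_neg h]

/-- The pass changes `U` in the single entry (x, y). The row of the unfinished y is still zero off
the diagonal, and `U x y = 0`, since an earlier use of column x would have left the low of y
strictly above that of x. The sum in `decomp` therefore changes by twice the column x, which is
zero. -/
theorem ReductionInvariant.lazyStep {D : Matrix ι ι (ZMod 2)} {P : ι → Prop}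
    {s : ReductionState ι} (hs : ReductionInvariant D P s) {y : ι} (hy : ¬ P y)
    (hP : ∀ x, x < y → P x) : ReductionInvariant D P (lazyStep y s) := by
  by_cases hne : (reducers y s).Nonempty
  swap
  · rwa [lazyStep_of_not_nonempty hne]
  obtain ⟨x, hx, he⟩ := lazyStep_of_nonempty hne
  rw [he]
  obtain ⟨hxy, hR, hlow⟩ := mem_reducers.1 hx
  have hRx : (fun i => s.R i x) ≠ 0 := fun h0 => by
    rw [h0, (low_eq_bot_iff _).2 rfl] at hlow
    exact hR ((low_eq_bot_iff _).1 hlow.symm)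
  have hUy : ∀ t, t ≠ y → s.U y t = 0 := fun t ht => by
    by_contra h
    exact hy (hs.lower y t (Ne.symm ht) h).2.1
  have hUx : s.U x y = 0 := by
    by_contra h
    exact (hs.lower x y hxy.ne h).2.2.2.ne hlow.symm
  have hlt := low_add_lt hR hlow
  refine ⟨fun t i => ?_, fun t => ?_, fun z t hzt hz => ?_, fun z w hz hw h0 hl => ?_⟩
  · rw [hs.decomp t i]
    by_cases ht : t = y
    · subst ht
      have h2 : (2 : ZMod 2) = 0 := by decide
      rw [← sub_eq_zero, ← Finset.sum_sub_distrib]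
      rw [Finset.sum_eq_add x t hxy.ne]
      · simp only [if_true, if_neg hxy.ne, if_neg hxy.ne', hUx, hs.diag]
        linear_combination -(s.R i x) * h2
      · rintro z - ⟨h1, h2⟩
        simp [h1, h2]
      · simp
      · simp
    · refine Finset.sum_congr rfl fun z _ => ?_
      by_cases hzy : z = y
      · subst hzy
        simp [hUy t ht, hxy.ne']
      · by_cases hzx : z = x
        · subst hzx; simp [hzy, hUy t ht]
        · simp [hzy, hzx]
  · by_cases ht : t = x
    · subst ht; simp [hs.diag, hUy t hxy.ne]
    · simp [ht, hs.diag]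
  · have hzU : s.U z t ≠ 0 ∨ (z = x ∧ t = y) := by
      by_cases hzx : z = x
      · subst hzx
        by_cases ht : t = y
        · exact Or.inr ⟨rfl, ht⟩
        · left
          simpa [hUy t ht] using hz
      · left
        simpa [hzx] using hz
    rcases hzU with h | ⟨rfl, rfl⟩
    · obtain ⟨h1, h2, h3, h4⟩ := hs.lower z t hzt h
      have hzy : z ≠ y := fun h => hy (h ▸ h2)
      refine ⟨h1, h2, by simpa [hzy] using h3, ?_⟩
      by_cases ht : t = y
      · subst ht
        simpa [hzy] using hlt.trans h4
      · simpa [hzy, ht] using h4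
    · refine ⟨hxy, hP _ hxy, by simpa [hxy.ne] using hRx, ?_⟩
      simpa [hxy.ne, hlow] using hlt
  · have hzy : z ≠ y := fun h => hy (h ▸ hz)
    have hwy : w ≠ y := fun h => hy (h ▸ hw)
    simp only [hzy, hwy, if_false] at h0 hl
    exact hs.distinct z w hz hw h0 hl

/-- The number of rows down to the low of a column. -/
def depth (y : ι) (s : ReductionState ι) : ℕ :=
  (Finset.univ.filter fun i : ι => (i : WithBot ι) ≤ low (fun j => s.R j y)).card

theorem depth_lazyStep_lt {y : ι} {s : ReductionState ι} (h : (reducers y s).Nonempty) :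
    depth y (lazyStep y s) < depth y s := by
  obtain ⟨x, hx, he⟩ := lazyStep_of_nonempty h
  rw [he]
  obtain ⟨hxy, hR, hlow⟩ := mem_reducers.1 hx
  have hlt := low_add_lt hR hlow
  obtain ⟨b, hb, -⟩ := exists_isLow hR
  refine Finset.card_lt_card ((Finset.ssubset_iff_of_subset fun i hi => ?_).2 ⟨b, ?_, ?_⟩)
  · simp only [Finset.mem_filter, Finset.mem_univ, true_and, if_true] at hi ⊢
    exact hi.trans hlt.le
  · simp [hb]
  · simpa [hb] using hlt

/-- Every effective pass lowers `depth`, which starts at no more than the number of rows. After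
`Fintype.card ι` passes either the loop has stopped or the depth is 0, and then no further pass can
be effective. -/
theorem reducers_iterate (y : ι) (s : ReductionState ι) (n : ℕ) :
    ¬ (reducers y ((lazyStep y)^[n] s)).Nonempty ∨
      depth y ((lazyStep y)^[n] s) + n ≤ Fintype.card ι := by
  induction n with
  | zero => exact Or.inr (Finset.card_filter_le _ _)
  | succ n ih =>
    rw [Function.iterate_succ_apply']
    by_cases h : (reducers y ((lazyStep y)^[n] s)).Nonempty
    · have := depth_lazyStep_lt h
      rcases ih with ih | ih
      · exact absurd h ih
      · right; omega
    · left
      rwa [lazyStep_of_not_nonempty h]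

theorem reducers_reduceColumn (y : ι) (s : ReductionState ι) :
    ¬ (reducers y (reduceColumn s y)).Nonempty := by
  rcases reducers_iterate y s (Fintype.card ι) with h | h
  · exact h
  · intro hne
    have := depth_lazyStep_lt hne
    unfold reduceColumn at this
    omega

theorem ReductionInvariant.reduceColumn {D : Matrix ι ι (ZMod 2)} {P : ι → Prop}
    {s : ReductionState ι} (hs : ReductionInvariant D P s) {y : ι} (hy : ∀ x, P x ↔ x < y) :
    ReductionInvariant D (fun x => x ≤ y) (reduceColumn s y) := by
  have h1 : ∀ n, ReductionInvariant D P ((_root_.lazyStep y)^[n] s) := by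
    intro n
    induction n with
    | zero => exact hs
    | succ n ih =>
      rw [Function.iterate_succ_apply']
      exact ih.lazyStep (by simp [hy]) (fun x => (hy x).2)
  have h2 : ReductionInvariant D P (_root_.reduceColumn s y) := h1 _
  have h3 := reducers_reduceColumn y s
  rw [Finset.not_nonempty_iff_eq_empty, Finset.eq_empty_iff_forall_notMem] at h3
  refine ⟨h2.decomp, h2.diag, fun x t hxt hU => ?_, fun x z hx hz h0 hl => ?_⟩
  · obtain ⟨ha, hb, hc⟩ := h2.lower x t hxt hU
    exact ⟨ha, ((hy x).1 hb).le, hc⟩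
  · rcases hx.lt_or_eq with hx | rfl <;> rcases hz.lt_or_eq with hz | rfl
    · exact h2.distinct x z ((hy x).2 hx) ((hy z).2 hz) h0 hl
    · refine absurd (mem_reducers.2 ⟨hx, fun h => ?_, hl⟩) (h3 x)
      rw [h, (low_eq_bot_iff _).2 rfl] at hl
      exact h0 ((low_eq_bot_iff _).1 hl)
    · exact absurd (mem_reducers.2 ⟨hz, h0, hl.symm⟩) (h3 z)
    · rfl

/-- The list `l` of columns still to be treated is arbitrary to allow induction; since it is sorted
and follows all of `P`, the finished columns are exactly those before its head. -/
theorem reductionInvariant_foldl (D : Matrix ι ι (ZMod 2)) (l : List ι)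
    (hl : l.Pairwise (· < ·)) (P : ι → Prop) (hP : ∀ x, P x ↔ x ∉ l)
    (hlt : ∀ x, P x → ∀ z ∈ l, x < z) (s : ReductionState ι) (hs : ReductionInvariant D P s) :
    ReductionInvariant D (fun _ => True) (l.foldl reduceColumn s) := by
  induction l generalizing P s with
  | nil =>
    have : P = fun _ => True := by ext x; simp [hP]
    simpa [this] using hs
  | cons y l ih =>
    rw [List.pairwise_cons] at hl
    have hy : ∀ x, P x ↔ x < y := fun x => by
      refine ⟨fun hx => hlt x hx y (by simp), fun hx => (hP x).2 fun hm => ?_⟩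
      rcases List.mem_cons.1 hm with h | h
      · exact hx.ne h
      · exact (hl.1 x h).not_gt hx
    refine ih hl.2 (fun x => x ≤ y) (fun x => ?_) (fun x hx z hz => hx.trans_lt (hl.1 z hz)) _
      (hs.reduceColumn hy)
    refine ⟨fun hx hm => (hl.1 x hm).not_ge hx, fun hx => ?_⟩
    by_contra hlt'
    have h1 : ¬ P x := fun h => hlt' ((hy x).1 h).le
    rw [hP, not_not, List.mem_cons] at h1
    rcases h1 with h | h
    · exact hlt' h.le
    · exact hx h

/-- Columns that are added share a low, and the dimension of that row determines the dimension of
both. -/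
theorem lazyReduction_homogeneous (D : Matrix ι ι (ZMod 2)) (dim : ι → ℕ)
    (hD : ∀ i j, D i j ≠ 0 → dim i + 1 = dim j) :
    (∀ i j, (lazyReduction D).R i j ≠ 0 → dim i + 1 = dim j) ∧
      ∀ i j, (lazyReduction D).U i j ≠ 0 → dim i = dim j := by
  have step : ∀ (y : ι) (s : ReductionState ι),
      ((∀ i j, s.R i j ≠ 0 → dim i + 1 = dim j) ∧ ∀ i j, s.U i j ≠ 0 → dim i = dim j) →
      ((∀ i j, (lazyStep y s).R i j ≠ 0 → dim i + 1 = dim j) ∧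
        ∀ i j, (lazyStep y s).U i j ≠ 0 → dim i = dim j) := by
    rintro y s ⟨h1, h2⟩
    by_cases hne : (reducers y s).Nonempty
    swap
    · rw [lazyStep_of_not_nonempty hne]; exact ⟨h1, h2⟩
    obtain ⟨x, hx, he⟩ := lazyStep_of_nonempty hne
    rw [he]
    obtain ⟨hxy, hR, hlow⟩ := mem_reducers.1 hx
    obtain ⟨b, hb, hb1⟩ := exists_isLow hR
    have hb2 := (low_eq_coe_iff _ b).1 (hlow.trans hb)
    have hdim : dim x = dim y := (h1 b x hb2.1).symm.trans (h1 b y hb1.1)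
    refine ⟨fun i j hij => ?_, fun i j hij => ?_⟩
    · by_cases hj : j = y
      · subst hj
        simp only [if_true] at hij
        by_cases h : s.R i j = 0
        · rw [h, zero_add] at hij
          rw [h1 i x hij, hdim]
        · exact h1 i j h
      · simp only [hj, if_false] at hij
        exact h1 i j hij
    · by_cases hi : i = x
      · subst hi
        simp only [if_true] at hij
        by_cases h : s.U i j = 0
        · rw [h, zero_add] at hij
          rw [hdim, h2 y j hij]
        · exact h2 i j h
      · simp only [hi, if_false] at hij
        exact h2 i j hij
  have main : ∀ (l : List ι) (s : ReductionState ι),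
      ((∀ i j, s.R i j ≠ 0 → dim i + 1 = dim j) ∧ ∀ i j, s.U i j ≠ 0 → dim i = dim j) →
      ((∀ i j, (l.foldl reduceColumn s).R i j ≠ 0 → dim i + 1 = dim j) ∧
        ∀ i j, (l.foldl reduceColumn s).U i j ≠ 0 → dim i = dim j) := by
    intro l
    induction l with
    | nil => exact fun s hs => hs
    | cons y l ih =>
      intro s hs
      refine ih _ ?_
      unfold reduceColumn
      induction Fintype.card ι with
      | zero => exact hs
      | succ n ihn =>
        rw [Function.iterate_succ_apply']
        exact step y _ ihn
  refine main _ _ ⟨hD, fun i j hij => ?_⟩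
  by_cases h : i = j
  · rw [h]
  · exact absurd (Matrix.one_apply_ne h) hij

theorem isLazyReduced_lazyReduction (D : Matrix ι ι (ZMod 2)) :
    IsLazyReduced (fun x y : ι => x < y) D (lazyReduction D).R (lazyReduction D).U := by
  have h : ReductionInvariant D (fun _ => True) (lazyReduction D) := by
    refine reductionInvariant_foldl D _ (Finset.sortedLT_sort _).pairwise (fun _ => False)
      (fun x => by simp) (fun x hx => hx.elim) _ ⟨fun t i => ?_, fun t => ?_, ?_, ?_⟩
    · simp [Matrix.one_apply]
    · simp
    · intro x t hxt hU
      exact absurd (Matrix.one_apply_ne hxt) hU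
    · exact fun x y hx => hx.elim
  refine ⟨h.decomp, h.diag, fun x t hxt hU => ?_, fun x y b hx hy => ?_,
    lazyReduction_homogeneous D⟩
  · obtain ⟨h1, -, h2, h3⟩ := h.lower x t hxt hU
    obtain ⟨b, hb, hb1⟩ := exists_isLow h2
    refine ⟨h1, b, hb1, fun z hz => ?_⟩
    by_contra hc
    have h4 := (le_low (c := fun i => (lazyReduction D).R i t) hc).trans_lt h3
    rw [hb, WithBot.coe_lt_coe] at h4
    rcases hz with rfl | hz
    · exact lt_irrefl _ h4
    · exact lt_asymm h4 hz
  · refine h.distinct x y trivial trivial (fun h0 => hx.1 (congrFun h0 b)) ?_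
    rw [(low_eq_coe_iff _ b).2 hx, (low_eq_coe_iff _ b).2 hy]

end LazyReductionInvariants

/-! ### Chains, boundary spaces and persistence pairs -/

section Chains

variable {X : Type*}

/-- The chains supported on the set `A`. -/
def chainsOn (A : Set X) : Submodule (ZMod 2) (X → ZMod 2) where
  carrier := {c | ∀ z, z ∉ A → c z = 0}
  add_mem' := fun {a b} ha hb z hz => by
    change a z + b z = 0
    rw [ha z hz, hb z hz, add_zero]
  zero_mem' := fun _ _ => rfl
  smul_mem' := fun r a ha z hz => by
    change r * a z = 0
    rw [ha z hz, mul_zero]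

theorem chainsOn_mono {A B : Set X} (h : A ⊆ B) : chainsOn A ≤ chainsOn B :=
  fun _ hc z hz => hc z fun ha => hz (h ha)

open Classical in
/-- The chain consisting of a single cell. -/
noncomputable def cellChain (d : X) : X → ZMod 2 := fun z => if z = d then 1 else 0

@[simp] theorem cellChain_self (d : X) : cellChain d d = 1 := by simp [cellChain]

theorem cellChain_of_ne {z d : X} (h : z ≠ d) : cellChain d z = 0 := by simp [cellChain, h]

theorem cellChain_mem {d : X} {A : Set X} (h : d ∈ A) : cellChain d ∈ chainsOn A :=
  fun _ hz => cellChain_of_ne fun e => hz (e ▸ h)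

variable [Fintype X]

theorem eq_sum_cellChain (c : X → ZMod 2) : c = ∑ z, c z • cellChain z := by
  ext i
  rw [Finset.sum_apply, Finset.sum_eq_single i]
  · simp
  · intro b _ hb
    simp [cellChain_of_ne (Ne.symm hb)]
  · simp

theorem chainsOn_le_iff {A : Set X} {p : Submodule (ZMod 2) (X → ZMod 2)} :
    chainsOn A ≤ p ↔ ∀ z ∈ A, cellChain z ∈ p := by
  refine ⟨fun h z hz => h (cellChain_mem hz), fun h c hc => ?_⟩
  rw [eq_sum_cellChain c]
  refine p.sum_mem fun z _ => ?_
  by_cases hz : z ∈ A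
  · exact p.smul_mem _ (h z hz)
  · rw [hc z hz, zero_smul]; exact p.zero_mem

/-- The linear map of the matrix `D`. -/
def boundary (D : X → X → ZMod 2) : (X → ZMod 2) →ₗ[ZMod 2] (X → ZMod 2) :=
  Matrix.mulVecLin (Matrix.of D)

theorem boundary_apply (D : X → X → ZMod 2) (c : X → ZMod 2) (i : X) :
    boundary D c i = ∑ j, D i j * c j := rfl

@[simp] theorem boundary_cellChain (D : X → X → ZMod 2) (d : X) :
    boundary D (cellChain d) = fun i => D i d := by
  ext i
  rw [boundary_apply, Finset.sum_eq_single d]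
  · simp
  · intro b _ hb; simp [cellChain_of_ne hb]
  · simp

/-- The boundaries of the chains supported on `A`. -/
def boundariesOf (D : X → X → ZMod 2) (A : Set X) : Submodule (ZMod 2) (X → ZMod 2) :=
  (chainsOn A).map (boundary D)

theorem boundary_mem_boundariesOf {D : X → X → ZMod 2} {A : Set X} {c : X → ZMod 2}
    (h : c ∈ chainsOn A) : boundary D c ∈ boundariesOf D A :=
  Submodule.mem_map_of_mem h

theorem column_mem_boundariesOf {D : X → X → ZMod 2} {A : Set X} {d : X} (h : d ∈ A) :
    (fun i => D i d) ∈ boundariesOf D A := by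
  rw [← boundary_cellChain]; exact boundary_mem_boundariesOf (cellChain_mem h)

theorem boundariesOf_mono {D : X → X → ZMod 2} {A B : Set X} (h : A ⊆ B) :
    boundariesOf D A ≤ boundariesOf D B :=
  Submodule.map_mono (chainsOn_mono h)

theorem boundariesOf_le_iff {D : X → X → ZMod 2} {A : Set X}
    {p : Submodule (ZMod 2) (X → ZMod 2)} :
    boundariesOf D A ≤ p ↔ ∀ z ∈ A, (fun i => D i z) ∈ p := by
  rw [boundariesOf, Submodule.map_le_iff_le_comap, chainsOn_le_iff]
  simp

/-- `b` is the low of the column of `d` in a reduced form of `D`, expressed without reduction. -/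
def IsPersistencePair (lt : X → X → Prop) (D : X → X → ZMod 2) (b d : X) : Prop :=
  (fun i => D i d) ∈ chainsOn {z | ¬ lt b z} ⊔ boundariesOf D {z | lt z d} ∧
    (fun i => D i d) ∉ chainsOn {z | lt z b} ⊔ boundariesOf D {z | lt z d}

theorem boundary_transpose_pairing (D : X → X → ZMod 2) (u v : X → ZMod 2) :
    ∑ z, boundary (fun i j => D j i) u z * v z = ∑ z, u z * boundary D v z := by
  simp only [boundary_apply, Finset.sum_mul, Finset.mul_sum]
  rw [Finset.sum_comm]
  exact Finset.sum_congr rfl fun z _ => Finset.sum_congr rfl fun w _ => by ring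

theorem pairing_eq_zero {A : Set X} {u v : X → ZMod 2} (hu : u ∈ chainsOn A)
    (hv : v ∈ chainsOn Aᶜ) : ∑ z, u z * v z = 0 := by
  refine Finset.sum_eq_zero fun z _ => ?_
  by_cases hz : z ∈ A
  · rw [hv z (by simpa using hz), mul_zero]
  · rw [hu z hz, zero_mul]

/-- Persistence pairs of the transposed matrix in the reversed order. -/
theorem IsPersistencePair.dual {lt : X → X → Prop} (htri : ∀ x y, lt x y ∨ x = y ∨ lt y x)
    (hasymm : ∀ x y, lt x y → ¬ lt y x) {D : X → X → ZMod 2} {b d : X}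
    (h : IsPersistencePair lt D b d) :
    IsPersistencePair (fun x y => lt y x) (fun i j => D j i) d b := by
  obtain ⟨h1, h2⟩ := h
  have hirr : ∀ x, ¬ lt x x := fun x hx => hasymm x x hx hx
  obtain ⟨f, hf, _, ⟨w, hw, rfl⟩, hfw⟩ := Submodule.mem_sup.1 h1
  -- A functional separates the column of d from the smaller space. Its values on cells form a
  -- cochain ψ that vanishes before b, equals 1 at b, and has coboundary vanishing before d.
  obtain ⟨φ, hφ, hker⟩ := Submodule.exists_le_ker_of_notMem h2
  have hφb : ∀ z, lt z b → φ (cellChain z) = 0 := fun z hz =>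
    hker (Submodule.mem_sup_left (cellChain_mem hz))
  have hφd : ∀ z, lt z d → φ (fun i => D i z) = 0 := fun z hz =>
    hker (Submodule.mem_sup_right (column_mem_boundariesOf hz))
  have hφw : φ (boundary D w) = 0 :=
    hker (Submodule.mem_sup_right (boundary_mem_boundariesOf hw))
  have hφval : ∀ c, φ c = ∑ z, φ (cellChain z) * c z := fun c => by
    conv_lhs => rw [eq_sum_cellChain c]
    rw [map_sum]
    exact Finset.sum_congr rfl fun z _ => by rw [map_smul, smul_eq_mul, mul_comm]
  have hφf : φ (cellChain b) * f b ≠ 0 := by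
    rw [← hfw, map_add, hφw, add_zero, hφval f, Finset.sum_eq_single b] at hφ
    · exact hφ
    · intro z _ hz
      rcases htri z b with h | h | h
      · rw [hφb z h, zero_mul]
      · exact absurd h hz
      · rw [hf z (not_not.2 h), mul_zero]
    · simp
  have hb1 := ZMod.two_eq_one_of_ne_zero (left_ne_zero_of_mul hφf)
  have hf1 := ZMod.two_eq_one_of_ne_zero (right_ne_zero_of_mul hφf)
  set D' : X → X → ZMod 2 := fun i j => D j i with hD'
  set ψ : X → ZMod 2 := fun z => φ (cellChain z) with hψ
  have hψD : ∀ x, boundary D' ψ x = φ (fun i => D i x) := fun x => by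
    rw [boundary_apply, hφval]
    exact Finset.sum_congr rfl fun z _ => mul_comm _ _
  constructor
  · have e : (fun i => D' i b) = boundary D' ψ + boundary D' (cellChain b - ψ) := by
      rw [map_sub, boundary_cellChain]; abel
    rw [e]
    refine Submodule.add_mem_sup (fun z hz => ?_) (boundary_mem_boundariesOf fun z hz => ?_)
    · rw [hψD, hφd z (not_not.1 hz)]
    · change cellChain b z - φ (cellChain z) = 0
      rcases htri z b with h | h | h
      · rw [hφb z h, cellChain_of_ne, sub_zero]
        rintro rfl
        exact hirr _ h
      · rw [h, hb1, cellChain_self, sub_self]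
      · exact absurd h hz
  · intro hmem
    -- The supposed decomposition is paired with the chain d - w. Its boundary f vanishes behind b
    -- and is 1 at b, so the coboundary of b pairs to 1 with it, whereas both summands pair to 0.
    obtain ⟨g, hg, _, ⟨u, hu, rfl⟩, hgu⟩ := Submodule.mem_sup.1 hmem
    have hv : boundary D (cellChain d - w) = f := by
      rw [map_sub, boundary_cellChain, ← hfw]; abel
    have e1 : ∑ z, (fun i => D' i b) z * (cellChain d - w) z = f b := by
      rw [← hv, boundary_apply]
    rw [← hgu] at e1
    have e2 : ∑ z, g z * (cellChain d - w) z = 0 := by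
      refine pairing_eq_zero hg fun z hz => ?_
      have hz : lt d z := by simpa using hz
      change cellChain d z - w z = 0
      rw [cellChain_of_ne, hw z (hasymm _ _ hz), sub_zero]
      rintro rfl
      exact hirr _ hz
    have e3 : ∑ z, boundary D' u z * (cellChain d - w) z = 0 := by
      rw [hD', boundary_transpose_pairing, hv]
      exact pairing_eq_zero hu fun z hz => hf z (by simpa using hz)
    simp only [Pi.add_apply, add_mul, Finset.sum_add_distrib] at e1
    rw [e2, e3, hf1] at e1
    exact absurd e1 (by decide)

end Chains

/-! ### Lazy reductions compute the persistence pairs -/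

section Reduced

variable {X : Type*} [Fintype X] [LinearOrder X] {D R U : X → X → ZMod 2}

theorem exists_isLow_of_ne {c : X → ZMod 2} {z : X} (h : c z ≠ 0) :
    ∃ b, z ≤ b ∧ IsLow (fun x y => x < y) c b := by
  obtain ⟨b, hb, hb1⟩ := exists_isLow (c := c) fun h0 => h (congrFun h0 z)
  exact ⟨b, by simpa [hb] using le_low h, hb1⟩

namespace IsLazyReduced

/-- The decomposition is solved for the reduced column of d; only columns before d enter, so
induction applies to them. -/
theorem column_sub_mem (hR : IsLazyReduced (fun x y => x < y) D R U) (d : X) :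
    ((fun i => R i d) - fun i => D i d) ∈ boundariesOf D {z | z < d} := by
  induction d using WellFoundedLT.induction with
  | ind d ih =>
    have e : ((fun i => R i d) - fun i => D i d) =
        -∑ x ∈ Finset.univ.erase d, U x d • fun i => R i x := by
      ext i
      simp only [Pi.sub_apply, Pi.neg_apply, Finset.sum_apply, Pi.smul_apply, smul_eq_mul]
      rw [hR.decomp d i, ← Finset.add_sum_erase _ _ (Finset.mem_univ d), hR.diag]
      ring
    rw [e]
    refine Submodule.neg_mem _ (Submodule.sum_mem _ fun x hx => ?_)
    by_cases h0 : U x d = 0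
    · rw [h0, zero_smul]; exact Submodule.zero_mem _
    have hlt := (hR.lower x d (Finset.ne_of_mem_erase hx) h0).1
    refine Submodule.smul_mem _ _ ?_
    have h1 := Submodule.add_mem _ (boundariesOf_mono (fun z hz => lt_trans hz hlt) (ih x hlt))
      (column_mem_boundariesOf (D := D) (show x ∈ {z | z < d} from hlt))
    rw [sub_add_cancel] at h1
    exact h1

theorem column_mem (hR : IsLazyReduced (fun x y => x < y) D R U) (d : X) :
    (fun i => R i d) ∈ boundariesOf D {z | z ≤ d} := by
  have := Submodule.add_mem _
    (boundariesOf_mono (fun z hz => le_of_lt hz) (hR.column_sub_mem d))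
    (column_mem_boundariesOf (D := D) (show d ∈ {z | z ≤ d} from le_rfl))
  rw [sub_add_cancel] at this
  exact this

/-- In a linear combination of reduced columns no lows cancel. -/
theorem apply_eq_zero_of_sum (hR : IsLazyReduced (fun x y => x < y) D R U) {a : X → ZMod 2}
    {b : X} (ha : ∀ z, b ≤ z → ∑ x, a x * R z x = 0) (x : X) (hx : a x ≠ 0) (z : X)
    (hz : b ≤ z) : R z x = 0 := by
  by_contra hne
  obtain ⟨b₀, hb₀, hl₀⟩ := exists_isLow_of_ne (c := fun i => R i x) hne
  -- The largest low m among the columns in use belongs to one column only, because lows are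
  -- distinct; all others vanish in row m.
  obtain ⟨m, ⟨y, hy, hly, hm⟩, hmax⟩ :=
    (Set.toFinite {m | ∃ y, a y ≠ 0 ∧ IsLow (fun x y : X => x < y) (fun i => R i y) m ∧
      b ≤ m}).exists_maximal ⟨b₀, x, hx, hl₀, hz.trans hb₀⟩
  have h1 := ha m hm
  rw [Finset.sum_eq_single y] at h1
  · exact (mul_ne_zero hy hly.1) h1
  · intro w _ hw
    by_contra hc
    obtain ⟨b₁, hb₁, hl₁⟩ := exists_isLow_of_ne (c := fun i => R i w) (right_ne_zero_of_mul hc)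
    have h2 : b₁ = m :=
      le_antisymm (hmax ⟨w, left_ne_zero_of_mul hc, hl₁, hm.trans hb₁⟩ hb₁) hb₁
    subst h2
    exact hw (hR.distinct w y _ hl₁ hly)
  · simp

theorem exists_coeff (hR : IsLazyReduced (fun x y => x < y) D R U) {d : X} {c : X → ZMod 2}
    (hc : c ∈ boundariesOf D {z | z < d}) :
    ∃ a : X → ZMod 2, (∀ x, a x ≠ 0 → x < d) ∧ c = fun i => ∑ x, a x * R i x := by
  have hle : boundariesOf D {z | z < d} ≤
      (chainsOn {z | z < d}).map (boundary R) := by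
    rw [boundariesOf_le_iff]
    intro z hz
    refine ⟨fun x => U x z, fun x hx => ?_, ?_⟩
    · by_contra h0
      by_cases hxz : x = z
      · exact hx (hxz ▸ hz)
      · exact hx (lt_trans (hR.lower x z hxz h0).1 hz)
    · ext i
      rw [boundary_apply, hR.decomp]
      exact Finset.sum_congr rfl fun _ _ => mul_comm _ _
  obtain ⟨a, ha, rfl⟩ := hle hc
  refine ⟨a, fun x hx => ?_, ?_⟩
  · by_contra h
    exact hx (ha x h)
  · ext i
    exact Finset.sum_congr rfl fun _ _ => mul_comm _ _

theorem isPersistencePair_of_isLow (hR : IsLazyReduced (fun x y => x < y) D R U) {b d : X}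
    (h : IsLow (fun x y => x < y) (fun i => R i d) b) :
    IsPersistencePair (fun x y => x < y) D b d := by
  have h0 := hR.column_sub_mem d
  constructor
  · have e : (fun i => D i d) = (fun i => R i d) + -((fun i => R i d) - fun i => D i d) := by abel
    rw [e]
    exact Submodule.add_mem_sup (fun z hz => h.2 z (not_not.1 hz)) (Submodule.neg_mem _ h0)
  · intro hmem
    obtain ⟨f, hf, g, hg, hfg⟩ := Submodule.mem_sup.1 hmem
    obtain ⟨a, ha, hga⟩ := hR.exists_coeff (Submodule.add_mem _ hg h0)
    have had : a d = 0 := by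
      by_contra hc
      exact lt_irrefl _ (ha d hc)
    have hs : ∀ i, R i d = f i + ∑ x, a x * R i x := fun i => by
      have h1 := congrFun hga i
      have h2 := congrFun hfg i
      simp only [Pi.add_apply, Pi.sub_apply] at h1 h2
      rw [← h1, ← h2]; ring
    -- The column of d plus earlier reduced columns would vanish from row b on. As lows never
    -- cancel, the column of d would itself vanish in row b.
    refine h.1 (hR.apply_eq_zero_of_sum (a := fun x => a x + cellChain d x) (b := b) ?_ d ?_ b
      le_rfl)
    · intro z hz
      simp only [add_mul, Finset.sum_add_distrib]
      have h3 : ∑ x, cellChain d x * R z x = R z d := by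
        rw [Finset.sum_eq_single d]
        · simp
        · intro w _ hw; simp [cellChain_of_ne hw]
        · simp
      have h4 := hs z
      rw [hf z (not_lt.2 hz), zero_add] at h4
      rw [h3, ← h4]
      exact CharTwo.add_self_eq_zero _
    · simp [had]

theorem isLow_iff (hR : IsLazyReduced (fun x y => x < y) D R U) {b d : X} :
    IsLow (fun x y => x < y) (fun i => R i d) b ↔
      IsPersistencePair (fun x y => x < y) D b d := by
  refine ⟨hR.isPersistencePair_of_isLow, fun h => ?_⟩
  by_cases h0 : (fun i => R i d) = 0
  · refine absurd (Submodule.mem_sup_right ?_) h.2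
    have := Submodule.neg_mem _ (hR.column_sub_mem d)
    simpa [h0] using this
  obtain ⟨b', -, hb'⟩ := exists_isLow h0
  have h' := hR.isPersistencePair_of_isLow hb'
  rcases lt_trichotomy b b' with hlt | rfl | hlt
  · exact absurd (sup_le_sup_right (chainsOn_mono fun z hz => (not_lt.1 hz).trans_lt hlt) _ h.1)
      h'.2
  · exact hb'
  · exact absurd (sup_le_sup_right (chainsOn_mono fun z hz => (not_lt.1 hz).trans_lt hlt) _ h'.1)
      h.2

/-- A birth has only one death. -/
theorem birth_unique (hR : IsLazyReduced (fun x y => x < y) D R U) {b d d' : X}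
    (h : IsPersistencePair (fun x y => x < y) D b d)
    (h' : IsPersistencePair (fun x y => x < y) D b d') : d = d' :=
  hR.distinct d d' b (hR.isLow_iff.2 h) (hR.isLow_iff.2 h')

/-- A death has only one birth. -/
theorem death_unique (hR : IsLazyReduced (fun x y => x < y) D R U) {b b' d : X}
    (h : IsPersistencePair (fun x y => x < y) D b d)
    (h' : IsPersistencePair (fun x y => x < y) D b' d) : b = b' := by
  have h1 := hR.isLow_iff.2 h
  have h2 := hR.isLow_iff.2 h'
  rcases lt_trichotomy b b' with hlt | hlt | hlt
  · exact absurd (h1.2 b' hlt) h2.1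
  · exact hlt
  · exact absurd (h2.2 b hlt) h1.1

/-- If `D * D = 0`, then no cell is both a birth and a death. -/
theorem birth_not_death (hR : IsLazyReduced (fun x y => x < y) D R U)
    (hD : ∀ c, boundary D (boundary D c) = 0) {a b d : X}
    (h : IsPersistencePair (fun x y => x < y) D b d) :
    ¬ IsPersistencePair (fun x y => x < y) D a b := by
  intro h'
  obtain ⟨h1, h3⟩ : R b d ≠ 0 ∧ ∀ z, b < z → R z d = 0 := hR.isLow_iff.2 h
  obtain ⟨c, -, hc⟩ := hR.column_mem d
  have h2 : boundary D (fun i => R i d) = 0 := by rw [← hc, hD]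
  -- The reduced column of d is a cycle with last cell b. Subtracting it from b leaves a chain
  -- before b with the boundary of b, so b cannot be a death.
  refine h'.2 (Submodule.mem_sup_right ?_)
  have e : (fun i => D i b) = boundary D (cellChain b - fun i => R i d) := by
    rw [map_sub, h2, sub_zero, boundary_cellChain]
  rw [e]
  refine boundary_mem_boundariesOf fun z hz => ?_
  change cellChain b z - R z d = 0
  rcases lt_trichotomy z b with hlt | rfl | hlt
  · exact absurd hlt hz
  · rw [cellChain_self, ZMod.two_eq_one_of_ne_zero h1, sub_self]
  · rw [cellChain_of_ne hlt.ne', h3 z hlt, sub_zero]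

end IsLazyReduced

end Reduced

/-! ### Birth-death pairs and cohomology -/

namespace LefschetzComplex

variable {X : Type*} [Fintype X] (K : LefschetzComplex X)

theorem boundary_boundary (c : X → ZMod 2) : boundary K.bd (boundary K.bd c) = 0 := by
  ext i
  simp only [boundary_apply, Finset.mul_sum]
  rw [Finset.sum_comm]
  refine Finset.sum_eq_zero fun j _ => ?_
  simp only [← mul_assoc, ← Finset.sum_mul, K.bd_bd, zero_mul]

theorem bd_self (x : X) : K.bd x x = 0 := by
  by_contra h
  have := K.dim_of_bd x x h
  omega

variable {K} in
theorem ne_of_bd {x y : X} (h : K.bd x y = 1) : x ≠ y := by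
  rintro rfl
  rw [bd_self] at h
  exact zero_ne_one h

end LefschetzComplex

namespace DiscreteMorseFunction

variable {X : Type*} [Fintype X] {K : LefschetzComplex X} (h : DiscreteMorseFunction K)

theorem order_lt_eq : (fun x y => h.order.lt x y) = h.lt := by
  funext x y
  exact propext (h.order_lt_iff x y)

theorem lt_trichotomy (x y : X) : h.lt x y ∨ x = y ∨ h.lt y x := by
  rw [← order_lt_eq]
  exact @_root_.lt_trichotomy X h.order x y

theorem lt_asymm (x y : X) (hxy : h.lt x y) : ¬ h.lt y x := by
  rw [← order_lt_eq] at hxy ⊢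
  exact @_root_.lt_asymm X h.order.toPreorder x y hxy

theorem isLazyReduced_homReduction :
    IsLazyReduced h.lt K.bd h.homReduction.R h.homReduction.U := by
  rw [← order_lt_eq]
  exact @isLazyReduced_lazyReduction X _ h.order K.bd

theorem isLazyReduced_cohomReduction :
    IsLazyReduced (fun x y => h.lt y x) (fun x y => K.bd y x) h.cohomReduction.R
      h.cohomReduction.U := by
  rw [← order_lt_eq]
  exact @isLazyReduced_lazyReduction Xᵒᵈ _ (@OrderDual.instLinearOrder X h.order)
    (fun i j => K.bd (OrderDual.ofDual j) (OrderDual.ofDual i))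

/-- `b` is the birth and `d` the death of a birth-death pair. -/
def IsPair (b d : X) : Prop := IsPersistencePair h.lt K.bd b d

theorem mem_birthDeath {p : X × X} : p ∈ h.birthDeath ↔ h.IsPair p.1 p.2 := by
  unfold IsPair birthDeath
  rw [← order_lt_eq]
  refine (@low_eq_coe_iff X _ h.order _ _).trans ?_
  exact @IsLazyReduced.isLow_iff X _ h.order K.bd _ _
    (@isLazyReduced_lazyReduction X _ h.order K.bd) p.1 p.2

variable {h}

theorem IsPair.isLow {R U : X → X → ZMod 2} (hR : IsLazyReduced h.lt K.bd R U) {b d : X} :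
    IsLow h.lt (fun i => R i d) b ↔ h.IsPair b d := by
  unfold IsPair
  rw [← order_lt_eq] at hR ⊢
  exact @IsLazyReduced.isLow_iff X _ h.order _ _ _ hR _ _

theorem IsPair.birth_unique {b d d' : X} (h1 : h.IsPair b d) (h2 : h.IsPair b d') : d = d' := by
  have hR := h.isLazyReduced_homReduction
  unfold IsPair at h1 h2
  rw [← order_lt_eq] at hR h1 h2
  exact @IsLazyReduced.birth_unique X _ h.order _ _ _ hR _ _ _ h1 h2

theorem IsPair.death_unique {b b' d : X} (h1 : h.IsPair b d) (h2 : h.IsPair b' d) : b = b' := by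
  have hR := h.isLazyReduced_homReduction
  unfold IsPair at h1 h2
  rw [← order_lt_eq] at hR h1 h2
  exact @IsLazyReduced.death_unique X _ h.order _ _ _ hR _ _ _ h1 h2

theorem IsPair.birth_not_death {a b d : X} (h1 : h.IsPair b d) : ¬ h.IsPair a b := by
  have hR := h.isLazyReduced_homReduction
  unfold IsPair at h1 ⊢
  rw [← order_lt_eq] at hR h1 ⊢
  exact @IsLazyReduced.birth_not_death X _ h.order _ _ _ hR K.boundary_boundary _ _ _ h1

theorem reduced_column_mem {R U : X → X → ZMod 2} (hR : IsLazyReduced h.lt K.bd R U) (d : X) :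
    (fun i => R i d) ∈ boundariesOf K.bd {z | ¬ h.lt d z} := by
  rw [← order_lt_eq] at hR ⊢
  refine boundariesOf_mono ?_ (@IsLazyReduced.column_mem X _ h.order _ _ _ hR d)
  exact fun z hz => @not_lt_of_ge X h.order.toPreorder _ _ hz

theorem boundary_mem_of_not_death {d : X} (hd : ∀ b, ¬ h.IsPair b d) :
    (fun i => K.bd i d) ∈ boundariesOf K.bd {z | h.lt z d} := by
  have hR := h.isLazyReduced_homReduction
  have h0 : (fun i => h.homReduction.R i d) = 0 := by
    by_contra hne
    obtain ⟨b, -, hb⟩ := @exists_isLow X _ h.order _ hne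
    rw [order_lt_eq] at hb
    exact hd b ((IsPair.isLow hR).1 hb)
  rw [← order_lt_eq] at hR ⊢
  have := Submodule.neg_mem _ (@IsLazyReduced.column_sub_mem X _ h.order _ _ _ hR d)
  rw [h0, zero_sub, neg_neg] at this
  exact this

theorem lt_of_bd {x y : X} (hxy : K.bd x y ≠ 0) : h.lt x y := by
  have h1 := h.mono x y (ZMod.two_eq_one_of_ne_zero hxy)
  have h2 := K.dim_of_bd x y hxy
  rcases h1.lt_or_eq with h1 | h1
  · exact Or.inl h1
  · exact Or.inr ⟨h1, by omega⟩

theorem lt_trans {x y z : X} (h1 : h.lt x y) (h2 : h.lt y z) : h.lt x z := by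
  rw [← order_lt_eq] at h1 h2 ⊢
  exact @_root_.lt_trans X h.order.toPreorder _ _ _ h1 h2

theorem IsPair.lt {b d : X} (hp : h.IsPair b d) : h.lt b d := by
  by_contra hlt
  refine hp.2 (Submodule.mem_sup_left fun z hz => ?_)
  by_contra hne
  refine hz ?_
  have h1 : h.lt z d := lt_of_bd hne
  rcases h.lt_trichotomy b d with h2 | rfl | h2
  · exact absurd h2 hlt
  · exact h1
  · exact lt_trans h1 h2

theorem IsPair.dim {b d : X} (hp : h.IsPair b d) : K.dim b + 1 = K.dim d := by
  have hR := h.isLazyReduced_homReduction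
  exact (hR.homogeneous K.dim K.dim_of_bd).1 b d ((IsPair.isLow hR).2 hp).1

/-! ### Vector field and critical cells -/

theorem mem_critCells {x : X} : x ∈ critCells h.vectorField ↔ ∀ z, h z = h x → z = x := by
  constructor
  · rintro ⟨-, a, ha⟩ z hz
    have h1 : x ∈ ({x} : Set X) := rfl
    rw [ha] at h1
    have h2 : z ∈ {z | h z = a} := hz.trans h1
    rw [← ha] at h2
    exact h2
  · refine fun hx => ⟨Set.singleton_nonempty x, h x, ?_⟩
    ext z
    exact ⟨fun hz => congrArg h hz, hx z⟩

theorem eq_or_eq_of_eq {x y z : X} (hxy : x ≠ y) (he : h x = h y) (hz : h z = h x) :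
    z = x ∨ z = y := by
  by_contra! hne
  have h1 := h.almost_injective (h x)
  have h2 : ({x, y, z} : Set X) ⊆ {w | h w = h x} := by
    rintro w (rfl | rfl | rfl)
    · rfl
    · exact he.symm
    · exact hz
  have h3 := Set.ncard_le_ncard h2 (Set.toFinite _)
  rw [Set.ncard_eq_three.2 ⟨x, y, z, hxy, hne.1.symm, hne.2.symm, rfl⟩] at h3
  omega

theorem pair_mem_vectorField {x y : X} (hxy : x ≠ y) :
    {x, y} ∈ h.vectorField ↔ h x = h y := by
  constructor
  · rintro ⟨-, a, ha⟩
    have h1 : x ∈ {z | h z = a} := ha ▸ Set.mem_insert _ _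
    have h2 : y ∈ {z | h z = a} := ha ▸ Set.mem_insert_of_mem _ rfl
    exact h1.trans h2.symm
  · refine fun he => ⟨⟨x, Set.mem_insert _ _⟩, h x, ?_⟩
    ext z
    constructor
    · rintro (rfl | rfl)
      · rfl
      · exact he.symm
    · exact eq_or_eq_of_eq hxy he

theorem lt_iff_of_mem_critCells_left {b z : X} (hb : b ∈ critCells h.vectorField) :
    h.lt b z ↔ h b < h z := by
  refine ⟨?_, Or.inl⟩
  rintro (h1 | ⟨h1, h2⟩)
  · exact h1
  · rw [mem_critCells.1 hb z h1.symm] at h2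
    exact absurd h2 (lt_irrefl _)

theorem lt_iff_of_mem_critCells_right {b z : X} (hb : b ∈ critCells h.vectorField) :
    h.lt z b ↔ h z < h b := by
  refine ⟨?_, Or.inl⟩
  rintro (h1 | ⟨h1, h2⟩)
  · exact h1
  · rw [mem_critCells.1 hb z h1] at h2
    exact absurd h2 (lt_irrefl _)

theorem eq_of_value_eq {x y : X} (hx : x ∈ critCells h.vectorField) (he : h y = h x) : y = x :=
  mem_critCells.1 hx y he

/-- The vectors are birth-death pairs. -/
theorem isPair_of_vector {x y : X} (hxy : K.bd x y = 1) (he : h x = h y) : h.IsPair x y := by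
  have hlt : h.lt x y := lt_of_bd (by rw [hxy]; exact one_ne_zero)
  constructor
  · refine Submodule.mem_sup_left fun z hz => ?_
    have hz : h.lt x z := not_not.1 hz
    by_contra hne
    have h1 : h z ≤ h y := h.mono z y (ZMod.two_eq_one_of_ne_zero hne)
    have h2 : h x ≤ h z := by
      rcases hz with hz | hz
      · exact hz.le
      · exact hz.1.le
    rcases eq_or_eq_of_eq (LefschetzComplex.ne_of_bd hxy) he (by linarith : h z = h x)
      with rfl | rfl
    · exact h.lt_asymm _ _ hz hz
    · exact hne (K.bd_self _)
  · intro hmem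
    obtain ⟨f, hf, _, ⟨w, hw, rfl⟩, hfw⟩ := Submodule.mem_sup.1 hmem
    have h1 := congrFun hfw x
    rw [hxy, Pi.add_apply, hf x (fun hx => h.lt_asymm _ _ hx hx), zero_add, boundary_apply,
      Finset.sum_eq_zero] at h1
    · exact zero_ne_one h1
    · intro z _
      by_cases hz : h.lt z y
      · by_contra hne
        have h2 : K.bd x z ≠ 0 := left_ne_zero_of_mul hne
        have h3 := h.mono x z (ZMod.two_eq_one_of_ne_zero h2)
        have h4 : h z ≤ h y := by
          rcases hz with hz | hz
          · exact hz.le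
          · exact hz.1.le
        rcases eq_or_eq_of_eq (LefschetzComplex.ne_of_bd hxy) he (by linarith : h z = h x)
          with rfl | rfl
        · exact h2 (K.bd_self _)
        · exact h.lt_asymm _ _ hz hz
      · rw [hw z hz, mul_zero]

theorem exists_vector_of_not_critCells {x : X} (hx : x ∉ critCells h.vectorField) :
    ∃ y, h y = h x ∧ (K.bd x y = 1 ∨ K.bd y x = 1) := by
  rw [mem_critCells] at hx
  push Not at hx
  obtain ⟨y, hy, hne⟩ := hx
  exact ⟨y, hy, h.pairing x y (Ne.symm hne) hy.symm⟩

/-- A noncritical cell lies in a vector, which is itself a pair on the diagonal; a cell has only one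
partner and only one role. -/
theorem IsPair.birth_mem_critCells {b d : X} (hp : h.IsPair b d) (hlt : h b < h d) :
    b ∈ critCells h.vectorField := by
  by_contra hb
  obtain ⟨y, hy, h1 | h1⟩ := exists_vector_of_not_critCells hb
  · rw [hp.birth_unique (isPair_of_vector h1 hy.symm), hy] at hlt
    exact lt_irrefl _ hlt
  · exact hp.birth_not_death (isPair_of_vector h1 hy)

theorem IsPair.death_mem_critCells {b d : X} (hp : h.IsPair b d) (hlt : h b < h d) :
    d ∈ critCells h.vectorField := by
  by_contra hb
  obtain ⟨y, hy, h1 | h1⟩ := exists_vector_of_not_critCells hb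
  · exact (isPair_of_vector h1 hy.symm).birth_not_death hp
  · rw [hp.death_unique (isPair_of_vector h1 hy), hy] at hlt
    exact lt_irrefl _ hlt

theorem IsPair.le {b d : X} (hp : h.IsPair b d) : h b ≤ h d := by
  rcases hp.lt with h1 | h1
  · exact h1.le
  · exact h1.1.le

theorem IsPair.ne {b d : X} (hp : h.IsPair b d) : b ≠ d := by
  rintro rfl
  exact h.lt_asymm _ _ hp.lt hp.lt

/-- A pair on the diagonal is a vector. -/
theorem IsPair.bd_of_eq {b d : X} (hp : h.IsPair b d) (he : h b = h d) : K.bd b d = 1 := by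
  rcases h.pairing b d hp.ne he with h1 | h1
  · exact h1
  · have h2 := K.dim_of_bd d b (by rw [h1]; exact one_ne_zero)
    have h3 := hp.dim
    omega

theorem IsPair.lt_of_mem_critCells {b d : X} (hp : h.IsPair b d)
    (hd : b ∈ critCells h.vectorField ∨ d ∈ critCells h.vectorField) : h b < h d := by
  rcases hd with hd | hd
  · exact (lt_iff_of_mem_critCells_left hd).1 hp.lt
  · exact (lt_iff_of_mem_critCells_right hd).1 hp.lt

/-! ### Elimination of the vectors -/

/-- The upper cells of the vectors of a vector field. -/
def _root_.upperCells (K : LefschetzComplex X) (V : Set (Set X)) : Set X :=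
  {y | ∃ x, K.bd x y = 1 ∧ {x, y} ∈ V}

/-- The chains on the critical cells in `A` plus the boundaries of the critical cells in `B`,
up to the acyclic subcomplex generated by the upper cells of the vectors. -/
def _root_.morseSum (K : LefschetzComplex X) (V : Set (Set X)) (A B : Set X) :
    Submodule (ZMod 2) (X → ZMod 2) :=
  (chainsOn (A ∩ critCells V) ⊔ boundariesOf K.bd (B ∩ critCells V)) ⊔
    (chainsOn (upperCells K V) ⊔ boundariesOf K.bd (upperCells K V))

theorem _root_.morseSum_mono {K : LefschetzComplex X} {V : Set (Set X)} {A A' B B' : Set X}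
    (hA : A ∩ critCells V ⊆ A') (hB : B ∩ critCells V ⊆ B') :
    morseSum K V A B ≤ morseSum K V A' B' := by
  have h1 : A ∩ critCells V ⊆ A' ∩ critCells V := fun _ hz => ⟨hA hz, hz.2⟩
  have h2 : B ∩ critCells V ⊆ B' ∩ critCells V := fun _ hz => ⟨hB hz, hz.2⟩
  exact sup_le_sup_right (sup_le_sup (chainsOn_mono h1) (boundariesOf_mono h2)) _

theorem mem_upperCells {y : X} :
    y ∈ upperCells K h.vectorField ↔ ∃ x, K.bd x y = 1 ∧ h x = h y := by
  refine exists_congr fun x => and_congr_right fun hxy => ?_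
  exact pair_mem_vectorField (LefschetzComplex.ne_of_bd hxy)

/-- Induction on the value. Upper cells are free in `morseSum`. A lower cell with partner y is ∂y,
also free, up to cells of smaller value. -/
theorem chainsOn_le_morseSum {L : Set X} (hL : ∀ z ∈ L, ∀ w, h w ≤ h z → w ∈ L) (B : Set X) :
    chainsOn L ≤ morseSum K h.vectorField L B := by
  rw [chainsOn_le_iff]
  have hwf : WellFounded fun x y : X => h x < h y :=
    have : IsTrans X fun x y : X => h x < h y := ⟨fun _ _ _ => _root_.lt_trans⟩
    have : Std.Irrefl fun x y : X => h x < h y := ⟨fun _ => lt_irrefl _⟩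
    Finite.wellFounded_of_trans_of_irrefl _
  intro x
  induction x using hwf.induction with
  | h x ih =>
  intro hx
  by_cases hc : x ∈ critCells h.vectorField
  · exact Submodule.mem_sup_left (Submodule.mem_sup_left (cellChain_mem ⟨hx, hc⟩))
  obtain ⟨y, hy, h1 | h1⟩ := exists_vector_of_not_critCells hc
  · have hyu : y ∈ upperCells K h.vectorField := mem_upperCells.2 ⟨x, h1, hy.symm⟩
    have h2 : chainsOn {z | h z < h x} ≤ morseSum K h.vectorField L B :=
      chainsOn_le_iff.2 fun z hz => ih z hz (hL x hx z (le_of_lt hz))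
    have h3 : (fun i => K.bd i y) - cellChain x ∈ chainsOn {z | h z < h x} := by
      intro z hz
      change K.bd z y - cellChain x z = 0
      by_cases hzx : z = x
      · rw [hzx, h1, cellChain_self, sub_self]
      rw [cellChain_of_ne hzx, sub_zero]
      by_contra hne
      have h4 := h.mono z y (ZMod.two_eq_one_of_ne_zero hne)
      have h5 : h x ≤ h z := not_lt.1 hz
      rcases eq_or_eq_of_eq (LefschetzComplex.ne_of_bd h1) hy.symm (by linarith : h z = h x)
        with h6 | h6
      · exact hzx h6
      · rw [h6] at hne
        exact hne (K.bd_self _)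
    have h4 : (fun i => K.bd i y) ∈ morseSum K h.vectorField L B :=
      Submodule.mem_sup_right (Submodule.mem_sup_right (column_mem_boundariesOf hyu))
    have h5 := Submodule.sub_mem _ h4 (h2 h3)
    rwa [sub_sub_cancel] at h5
  · exact Submodule.mem_sup_right (Submodule.mem_sup_left
      (cellChain_mem (mem_upperCells.2 ⟨y, h1, hy⟩)))

/-- Since ∂∂ = 0, only the chain parts survive, and they become boundary parts. -/
theorem boundary_mem_of_mem_sup {A : Set X} {c : X → ZMod 2} {P : Set X}
    (hc : c ∈ morseSum K h.vectorField A P) (B : Set X) :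
    boundary K.bd c ∈ morseSum K h.vectorField B A := by
  obtain ⟨u, hu, v, hv, rfl⟩ := Submodule.mem_sup.1 hc
  obtain ⟨u1, hu1, _, ⟨u2, hu2, rfl⟩, rfl⟩ := Submodule.mem_sup.1 hu
  obtain ⟨v1, hv1, _, ⟨v2, hv2, rfl⟩, rfl⟩ := Submodule.mem_sup.1 hv
  simp only [map_add, K.boundary_boundary, add_zero]
  exact Submodule.add_mem_sup (Submodule.mem_sup_right (boundary_mem_boundariesOf hu1))
    (Submodule.mem_sup_right (boundary_mem_boundariesOf hv1))

theorem boundariesOf_le_morseSum {L : Set X} (hL : ∀ z ∈ L, ∀ w, h w ≤ h z → w ∈ L)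
    (A : Set X) : boundariesOf K.bd L ≤ morseSum K h.vectorField A L := by
  rintro _ ⟨c, hc, rfl⟩
  exact boundary_mem_of_mem_sup (chainsOn_le_morseSum hL ∅ hc) A

/-- A chain on upper cells is determined by the lower cells in its boundary. -/
theorem mem_chainsOn_of_boundary {u : X → ZMod 2} (hu : u ∈ chainsOn (upperCells K h.vectorField))
    {L : Set X} (hL : ∀ z ∈ L, ∀ w, h w ≤ h z → w ∈ L)
    (hb : ∀ x, x ∉ L → boundary K.bd u x = 0) : u ∈ chainsOn L := by
  intro z hz
  by_contra hne
  -- For y of maximal value, the coefficient of its partner x in the boundary is `u y` alone: any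
  -- other cofacet of x in the support would lie outside `L` and strictly higher.
  obtain ⟨y, ⟨hy, hyu⟩, hmax⟩ := (Set.toFinite {y | y ∉ L ∧ u y ≠ 0}).exists_maximalFor h.toFun _
    ⟨z, hz, hne⟩
  have hyU : y ∈ upperCells K h.vectorField := by
    by_contra hc
    exact hyu (hu y hc)
  obtain ⟨x, hxy, he⟩ := mem_upperCells.1 hyU
  have hxL : x ∉ L := fun hx => hy (hL x hx y he.ge)
  have h1 := hb x hxL
  rw [boundary_apply, Finset.sum_eq_single y] at h1
  · rw [hxy, one_mul] at h1
    exact hyu h1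
  · intro j _ hj
    by_contra hc
    have h2 := h.mono x j (ZMod.two_eq_one_of_ne_zero (left_ne_zero_of_mul hc))
    have h3 : h j ≤ h y := by
      by_contra hlt
      have := hmax (j := j) ⟨fun hjL => hxL (hL j hjL x h2), right_ne_zero_of_mul hc⟩
        (le_of_lt (not_le.1 hlt))
      exact hlt this
    rcases eq_or_eq_of_eq (LefschetzComplex.ne_of_bd hxy) he (by linarith : h j = h x)
      with rfl | h4
    · exact left_ne_zero_of_mul hc (K.bd_self _)
    · exact hj h4
  · simp

/-- The upper cells in `morseSum` carry no height bound, which removes the values of the vectors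
from the condition. The bounds come back by themselves: ∂∂ = 0 puts ∂u into `L`, then the identity
itself puts ∂w' below d, and a chain on upper cells is as low as its boundary. -/
theorem mem_sup_iff_mem_morseSum {d : X} (hd : d ∈ critCells h.vectorField) {L : Set X}
    (hL : ∀ z ∈ L, ∀ w, h w ≤ h z → w ∈ L) (hLd : ∀ z ∈ L, h z < h d) :
    (fun i => K.bd i d) ∈ chainsOn L ⊔ boundariesOf K.bd {z | h z < h d} ↔
      (fun i => K.bd i d) ∈ morseSum K h.vectorField L {z | h z < h d} := by
  have hM : ∀ z ∈ {z | h z < h d}, ∀ w, h w ≤ h z → w ∈ {z | h z < h d} :=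
    fun z hz w hw => hw.trans_lt hz
  constructor
  · intro hmem
    exact sup_le (chainsOn_le_morseSum hL _) (boundariesOf_le_morseSum hM _) hmem
  · intro hmem
    obtain ⟨p, hp, v, hv, e⟩ := Submodule.mem_sup.1 hmem
    obtain ⟨f, hf, _, ⟨w, hw, rfl⟩, rfl⟩ := Submodule.mem_sup.1 hp
    obtain ⟨u, hu, _, ⟨w', hw', rfl⟩, rfl⟩ := Submodule.mem_sup.1 hv
    have hf' : f ∈ chainsOn L := chainsOn_mono Set.inter_subset_left hf
    have hw1 : w ∈ chainsOn {z | h z < h d} := chainsOn_mono Set.inter_subset_left hw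
    have bd_low : ∀ {S : Set X} {c : X → ZMod 2}, (∀ z ∈ S, ∀ w, h w ≤ h z → w ∈ S) →
        c ∈ chainsOn S → boundary K.bd c ∈ chainsOn S := by
      intro S c hS hc x hx
      rw [boundary_apply]
      refine Finset.sum_eq_zero fun j _ => ?_
      by_contra hne
      refine hne ?_
      rw [hc j fun hj => hx (hS j hj x
        (h.mono x j (ZMod.two_eq_one_of_ne_zero (left_ne_zero_of_mul hne)))), mul_zero]
    have hu' : u ∈ chainsOn L := by
      refine mem_chainsOn_of_boundary hu hL fun x hx => ?_
      have e1 := congrArg (boundary K.bd) e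
      rw [← boundary_cellChain K.bd d] at e1
      simp only [map_add, K.boundary_boundary, add_zero] at e1
      have e2 := congrFun e1 x
      rw [Pi.add_apply, bd_low hL hf' x hx, zero_add] at e2
      exact e2
    have hw2 : w' ∈ chainsOn {z | h z < h d} := by
      refine mem_chainsOn_of_boundary hw' hM fun x hx => ?_
      have e1 := congrFun e x
      have hxL : x ∉ L := fun h1 => hx (hLd x h1)
      have h0 : K.bd x d = 0 := by
        by_contra hc
        have h1 := h.mono x d (ZMod.two_eq_one_of_ne_zero hc)
        have h2 : h d ≤ h x := not_lt.1 hx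
        rw [eq_of_value_eq hd (le_antisymm h1 h2)] at hc
        exact hc (K.bd_self d)
      simp only [Pi.add_apply] at e1
      rw [hf' x hxL, hu' x hxL, bd_low hM hw1 x hx, h0, zero_add, zero_add, zero_add] at e1
      exact e1
    rw [← e]
    have e3 : f + boundary K.bd w + (u + boundary K.bd w') = f + u + boundary K.bd (w + w') := by
      rw [map_add]; abel
    rw [e3]
    exact Submodule.add_mem_sup (Submodule.add_mem _ hf' hu')
      (boundary_mem_boundariesOf (Submodule.add_mem _ hw1 hw2))

end DiscreteMorseFunction

namespace DiscreteMorseFunction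

variable {X : Type*} [Fintype X] {K : LefschetzComplex X} {h g g' : DiscreteMorseFunction K}

/-! ### Pairs of critical cells in terms of the critical cells alone -/

theorem isPair_iff {b d : X} (hb : b ∈ critCells h.vectorField) (hd : d ∈ critCells h.vectorField)
    (hlt : h b < h d) :
    h.IsPair b d ↔
      (fun i => K.bd i d) ∈ morseSum K h.vectorField {z | h z ≤ h b} {z | h z < h d} ∧
      (fun i => K.bd i d) ∉ morseSum K h.vectorField {z | h z < h b} {z | h z < h d} := by
  have e1 : {z | ¬ h.lt b z} = {z | h z ≤ h b} := by
    ext z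
    simp only [Set.mem_ofPred_eq, lt_iff_of_mem_critCells_left hb, not_lt]
  have e2 : {z | h.lt z b} = {z | h z < h b} := by
    ext z
    simp only [Set.mem_ofPred_eq, lt_iff_of_mem_critCells_right hb]
  have e3 : {z | h.lt z d} = {z | h z < h d} := by
    ext z
    simp only [Set.mem_ofPred_eq, lt_iff_of_mem_critCells_right hd]
  unfold IsPair IsPersistencePair
  rw [e1, e2, e3, mem_sup_iff_mem_morseSum hd, mem_sup_iff_mem_morseSum hd]
  · exact fun z hz w hw => hw.trans_lt hz
  · exact fun z hz => _root_.lt_trans hz hlt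
  · exact fun z hz w hw => hw.trans hz
  · exact fun z hz => (show h z ≤ h b from hz).trans_lt hlt

theorem _root_.morseSum_congr {K : LefschetzComplex X} {V : Set (Set X)} {A A' B B' : Set X}
    (hA : ∀ z ∈ critCells V, z ∈ A ↔ z ∈ A') (hB : ∀ z ∈ critCells V, z ∈ B ↔ z ∈ B') :
    morseSum K V A B = morseSum K V A' B' :=
  le_antisymm (morseSum_mono (fun z hz => (hA z hz.2).1 hz.1) fun z hz => (hB z hz.2).1 hz.1)
    (morseSum_mono (fun z hz => (hA z hz.2).2 hz.1) fun z hz => (hB z hz.2).2 hz.1)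

theorem _root_.mem_morseSum_insert_right {K : LefschetzComplex X} {V : Set (Set X)}
    {A B : Set X} {x : X} {c : X → ZMod 2} (hc : c ∈ morseSum K V A (insert x B)) :
    c ∈ morseSum K V A B ∨ (c - fun i => K.bd i x) ∈ morseSum K V A B := by
  have hle : morseSum K V A (insert x B) ≤ morseSum K V A B ⊔ Submodule.span _
      {fun i => K.bd i x} := by
    refine sup_le (sup_le ?_ (boundariesOf_le_iff.2 ?_)) ?_
    · exact (le_sup_left.trans le_sup_left).trans le_sup_left
    · rintro z ⟨rfl | hz, hz'⟩
      · exact Submodule.mem_sup_right (Submodule.mem_span_singleton_self _)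
      · exact Submodule.mem_sup_left (Submodule.mem_sup_left (Submodule.mem_sup_right
          (column_mem_boundariesOf ⟨hz, hz'⟩)))
    · exact le_sup_right.trans le_sup_left
  obtain ⟨u, hu, v, hv, rfl⟩ := Submodule.mem_sup.1 (hle hc)
  obtain ⟨a, rfl⟩ := Submodule.mem_span_singleton.1 hv
  by_cases ha : a = 0
  · left; simpa [ha] using hu
  · right
    rw [ZMod.two_eq_one_of_ne_zero ha, one_smul, add_sub_cancel_right]
    exact hu

theorem _root_.mem_morseSum_insert_left {K : LefschetzComplex X} {V : Set (Set X)}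
    {A B : Set X} {x : X} {c : X → ZMod 2} (hc : c ∈ morseSum K V (insert x A) B) :
    c ∈ morseSum K V A B ∨ c - cellChain x ∈ morseSum K V A B := by
  have hle : morseSum K V (insert x A) B ≤ morseSum K V A B ⊔ Submodule.span _
      {cellChain x} := by
    refine sup_le (sup_le (chainsOn_le_iff.2 ?_) ?_) ?_
    · rintro z ⟨rfl | hz, hz'⟩
      · exact Submodule.mem_sup_right (Submodule.mem_span_singleton_self _)
      · exact Submodule.mem_sup_left (Submodule.mem_sup_left (Submodule.mem_sup_left
          (cellChain_mem ⟨hz, hz'⟩)))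
    · exact (le_sup_right.trans le_sup_left).trans le_sup_left
    · exact le_sup_right.trans le_sup_left
  obtain ⟨u, hu, v, hv, rfl⟩ := Submodule.mem_sup.1 (hle hc)
  obtain ⟨a, rfl⟩ := Submodule.mem_span_singleton.1 hv
  by_cases ha : a = 0
  · left; simpa [ha] using hu
  · right
    rw [ZMod.two_eq_one_of_ne_zero ha, one_smul, add_sub_cancel_right]
    exact hu

/-- A death is never a birth: if t were needed, taking boundaries would express ∂t by boundaries of
cells in `A`, all before t, contrary to the pairing of t with s. -/
theorem mem_morseSum_of_insert_death {s t d : X} (hst : h.IsPair s t) (hlt : h s < h t)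
    {A B : Set X} (hA : A ⊆ {z | h z < h t})
    (hd : (fun i => K.bd i d) ∈ morseSum K h.vectorField (insert t A) B) :
    (fun i => K.bd i d) ∈ morseSum K h.vectorField A B := by
  rcases mem_morseSum_insert_left hd with h1 | h1
  · exact h1
  · have h2 := boundary_mem_of_mem_sup h1 {z | h z < h s}
    rw [map_sub, ← boundary_cellChain, K.boundary_boundary, zero_sub, Submodule.neg_mem_iff,
      boundary_cellChain] at h2
    exact absurd (morseSum_mono Set.inter_subset_left (Set.inter_subset_left.trans hA) h2)
      ((isPair_iff (hst.birth_mem_critCells hlt) (hst.death_mem_critCells hlt) hlt).1 hst).2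

theorem isPair_of_same_vector (hV : g.vectorField = g'.vectorField) {b d : X}
    (hp : g.IsPair b d) (he : g b = g d) : g'.IsPair b d := by
  have h1 := hp.bd_of_eq he
  have h2 := LefschetzComplex.ne_of_bd h1
  refine isPair_of_vector h1 ((pair_mem_vectorField h2).1 ?_)
  rw [← hV]
  exact (pair_mem_vectorField h2).2 he

theorem eq_iff_eq_of_vectorField_eq (hV : g.vectorField = g'.vectorField) (x y : X) :
    g x = g y ↔ g' x = g' y := by
  by_cases hxy : x = y
  · subst hxy; simp
  · rw [← pair_mem_vectorField hxy, hV, pair_mem_vectorField hxy]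

/-- Birth-death pairs depend only on the vector field and on the order of the critical cells. -/
theorem birthDeath_eq_of_lt_iff (hV : g.vectorField = g'.vectorField)
    (hord : ∀ x ∈ critCells g.vectorField, ∀ y ∈ critCells g.vectorField,
      (g x < g y ↔ g' x < g' y)) : g.birthDeath = g'.birthDeath := by
  have key : ∀ {g g' : DiscreteMorseFunction K}, g.vectorField = g'.vectorField →
      (∀ x ∈ critCells g.vectorField, ∀ y ∈ critCells g.vectorField,
        (g x < g y ↔ g' x < g' y)) → ∀ b d, g.IsPair b d → g'.IsPair b d := by
    intro g g' hV hord b d hp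
    rcases hp.le.lt_or_eq with hlt | he
    swap
    · exact isPair_of_same_vector hV hp he
    have hb := hp.birth_mem_critCells hlt
    have hd := hp.death_mem_critCells hlt
    rw [isPair_iff hb hd hlt] at hp
    rw [isPair_iff (hV ▸ hb) (hV ▸ hd) ((hord b hb d hd).1 hlt), ← hV]
    have e1 : ∀ z ∈ critCells g.vectorField, g' z ≤ g' b ↔ g z ≤ g b := fun z hz => by
      rw [← not_lt, ← not_lt, hord b hb z hz]
    refine ⟨?_, fun hm => hp.2 ?_⟩
    · rw [morseSum_congr (A := {z | g' z ≤ g' b}) (B := {z | g' z < g' d}) e1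
        fun z hz => (hord z hz d hd).symm]
      exact hp.1
    · rw [morseSum_congr (A := {z | g z < g b}) (B := {z | g z < g d})
        (fun z hz => hord z hz b hb) fun z hz => hord z hz d hd]
      exact hm
  ext ⟨b, d⟩
  rw [mem_birthDeath, mem_birthDeath]
  exact ⟨key hV hord b d, key hV.symm (fun x hx y hy => (hord x (hV ▸ hx) y (hV ▸ hy)).symm) b d⟩

/-! ### Exchange of a death with the adjacent critical cell -/

/-- The death `t` of a pair `(s, t)` moves below the adjacent critical cell `x`. -/
structure DeathSwap (g g' : DiscreteMorseFunction K) (s t x : X) : Prop where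
  vectorField_eq : g.vectorField = g'.vectorField
  isPair : g.IsPair s t
  crit : x ∈ critCells g.vectorField
  lt_left : g s < g x
  lt_right : g x < g t
  eq_of_ne : ∀ z ∈ critCells g.vectorField, z ≠ t → g' z = g z
  below : g' t < g x
  adjacent : ∀ z ∈ critCells g.vectorField, z ≠ x → g z < g t → g z < g' t
  -- Only for nested pairs s < b < x < t can the exchange alter the pairing; the condition says that
  -- ∂t can be reduced below b without x.
  unblocked : ∀ b, g.IsPair b x → g s < g b →
    (fun i => K.bd i t) ∈ morseSum K g.vectorField {z | g z < g b} {z | g z < g x}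

namespace DeathSwap

variable {s t x : X}

theorem death_crit (H : DeathSwap g g' s t x) : t ∈ critCells g.vectorField :=
  H.isPair.death_mem_critCells (H.lt_left.trans H.lt_right)

theorem birth_crit (H : DeathSwap g g' s t x) : s ∈ critCells g.vectorField :=
  H.isPair.birth_mem_critCells (H.lt_left.trans H.lt_right)

theorem ne (H : DeathSwap g g' s t x) : x ≠ t := by
  rintro rfl; exact lt_irrefl _ H.lt_right

theorem birth_ne (H : DeathSwap g g' s t x) : s ≠ t := H.isPair.ne

theorem birth_ne' (H : DeathSwap g g' s t x) : s ≠ x := by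
  rintro rfl; exact lt_irrefl _ H.lt_left

theorem lt_iff_right (H : DeathSwap g g' s t x) {z : X} (hz : z ∈ critCells g.vectorField)
    (hzx : z ≠ x) : g z < g t ↔ g z < g' t :=
  ⟨H.adjacent z hz hzx, fun h1 => h1.trans (H.below.trans H.lt_right)⟩

theorem lt_iff (H : DeathSwap g g' s t x) {z w : X} (hz : z ∈ critCells g.vectorField)
    (hw : w ∈ critCells g.vectorField) (hne : ¬ (z = x ∧ w = t ∨ z = t ∧ w = x)) :
    g z < g w ↔ g' z < g' w := by
  by_cases hzt : z = t
  · by_cases hwt : w = t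
    · simp [hzt, hwt]
    · subst hzt
      have hwx : w ≠ x := fun h1 => hne (Or.inr ⟨rfl, h1⟩)
      have h2 := H.lt_iff_right hw hwx
      have h3 : g z ≠ g w := fun h1 => hwt (eq_of_value_eq H.death_crit h1.symm)
      have h4 : g' z ≠ g' w :=
        fun h1 => h3 ((eq_iff_eq_of_vectorField_eq H.vectorField_eq _ _).2 h1)
      rw [H.eq_of_ne w hw hwt] at h4 ⊢
      constructor
      · intro h5
        exact lt_of_le_of_ne (not_lt.1 fun h6 => _root_.lt_asymm h5 (h2.2 h6)) h4
      · intro h5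
        exact lt_of_le_of_ne (not_lt.1 fun h6 => _root_.lt_asymm h5 (h2.1 h6)) h3
  · rw [H.eq_of_ne z hz hzt]
    by_cases hwt : w = t
    · subst hwt
      exact H.lt_iff_right hz fun h1 => hne (Or.inl ⟨h1, rfl⟩)
    · rw [H.eq_of_ne w hw hwt]

theorem le_iff (H : DeathSwap g g' s t x) {z w : X} (hz : z ∈ critCells g.vectorField)
    (hw : w ∈ critCells g.vectorField) (hne : ¬ (z = x ∧ w = t ∨ z = t ∧ w = x)) :
    g z ≤ g w ↔ g' z ≤ g' w := by
  rw [← not_lt, ← not_lt, H.lt_iff hw hz (by tauto)]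

theorem lt_death_iff (H : DeathSwap g g' s t x) {z : X} (hz : z ∈ critCells g.vectorField) :
    g z < g t ↔ z ∈ insert x {z | g z < g x} := by
  constructor
  · intro h1
    by_cases hzx : z = x
    · exact Or.inl hzx
    · exact Or.inr ((H.adjacent z hz hzx h1).trans H.below)
  · rintro (rfl | h1)
    · exact H.lt_right
    · exact _root_.lt_trans h1 H.lt_right

theorem lt_death_iff' (H : DeathSwap g g' s t x) {z : X} (hz : z ∈ critCells g.vectorField) :
    g' z < g' t ↔ z ∈ {z | g z < g x} := by
  by_cases hzt : z = t
  · subst hzt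
    exact ⟨fun h1 => absurd h1 (lt_irrefl _), fun h1 => absurd h1 H.lt_right.not_gt⟩
  · rw [H.eq_of_ne z hz hzt]
    refine ⟨fun h1 => h1.trans H.below, fun h1 => H.adjacent z hz ?_ (h1.trans H.lt_right)⟩
    rintro rfl
    exact lt_irrefl (g z) h1

theorem lt_swapped_iff (H : DeathSwap g g' s t x) {z : X} (hz : z ∈ critCells g.vectorField) :
    g' z < g' x ↔ z ∈ insert t {z | g z < g x} := by
  rw [H.eq_of_ne x H.crit H.ne]
  by_cases hzt : z = t
  · subst hzt
    exact ⟨fun _ => Or.inl rfl, fun _ => H.below⟩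
  · rw [H.eq_of_ne z hz hzt]
    exact ⟨Or.inr, fun h1 => h1.resolve_left hzt⟩

/-- The sets in the criterion change only for b = x, where t joins the chains; being a death, it
makes no difference. -/
theorem isPair_iff_of_ne (H : DeathSwap g g' s t x) {b d : X}
    (hb : b ∈ critCells g.vectorField) (hd : d ∈ critCells g.vectorField) (hlt : g b < g d)
    (hbt : b ≠ t) (hdx : d ≠ x) (hdt : d ≠ t) : g.IsPair b d ↔ g'.IsPair b d := by
  have hV := H.vectorField_eq
  have e1 := H.eq_of_ne b hb hbt
  have e2 := H.eq_of_ne d hd hdt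
  rw [isPair_iff hb hd hlt, isPair_iff (hV ▸ hb) (hV ▸ hd) (by rwa [e1, e2]), ← hV]
  have hB : ∀ A, morseSum K g.vectorField A {z | g' z < g' d} =
      morseSum K g.vectorField A {z | g z < g d} := fun A =>
    morseSum_congr (fun _ _ => Iff.rfl) fun z hz => (H.lt_iff hz hd (by tauto)).symm
  rw [hB, hB]
  by_cases hbx : b = x
  · subst hbx
    have hlow : ∀ z ∈ critCells g.vectorField, g z ≤ g b ↔ z ∈ insert b {z | g z < g b} :=
      fun z _ => ⟨fun h1 => h1.lt_or_eq.elim Or.inr fun h2 => Or.inl (eq_of_value_eq hb h2),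
        fun h1 => h1.elim (fun h2 => h2 ▸ le_rfl) fun h2 => le_of_lt h2⟩
    have hlow' : ∀ z ∈ critCells g.vectorField,
        g' z ≤ g' b ↔ z ∈ insert t (insert b {z | g z < g b}) := fun z hz => by
      have h1 := H.lt_swapped_iff hz
      have h2 : g' z = g' b ↔ z = b :=
        ⟨fun h3 => eq_of_value_eq (hV ▸ hb) h3, fun h3 => h3 ▸ rfl⟩
      rw [le_iff_lt_or_eq, h1, h2]
      simp only [Set.mem_insert_iff]
      tauto
    have hins : insert b {z | g z < g b} ⊆ {z | g z < g t} := by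
      rintro z (rfl | hz)
      · exact H.lt_right
      · exact _root_.lt_trans hz H.lt_right
    have hst := H.lt_left.trans H.lt_right
    refine and_congr ?_ (not_congr ?_)
    · rw [morseSum_congr (A := {z | g z ≤ g b}) hlow fun _ _ => Iff.rfl,
        morseSum_congr (A := {z | g' z ≤ g' b}) hlow' fun _ _ => Iff.rfl]
      exact ⟨fun h1 => morseSum_mono (Set.inter_subset_left.trans (Set.subset_insert _ _))
        Set.inter_subset_left h1, mem_morseSum_of_insert_death H.isPair hst hins⟩
    · rw [morseSum_congr (A := {z | g' z < g' b}) (fun z hz => H.lt_swapped_iff hz)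
        fun _ _ => Iff.rfl]
      exact ⟨fun h1 => morseSum_mono (Set.inter_subset_left.trans (Set.subset_insert _ _))
        Set.inter_subset_left h1,
        mem_morseSum_of_insert_death H.isPair hst ((Set.subset_insert _ _).trans hins)⟩
  · rw [morseSum_congr (A := {z | g' z ≤ g' b}) (A' := {z | g z ≤ g b})
      (fun z hz => (H.le_iff hz hb (by tauto)).symm) fun _ _ => Iff.rfl,
      morseSum_congr (A := {z | g' z < g' b}) (A' := {z | g z < g b})
      (fun z hz => (H.lt_iff hz hb (by tauto)).symm) fun _ _ => Iff.rfl]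

theorem column_mem_of_not_death (H : DeathSwap g g' s t x) (hx : ∀ b, ¬ g.IsPair b x)
    (A : Set X) : (fun i => K.bd i x) ∈ morseSum K g.vectorField A {z | g z < g x} := by
  have h1 := boundary_mem_of_not_death hx
  simp only [lt_iff_of_mem_critCells_right H.crit] at h1
  exact boundariesOf_le_morseSum (fun z hz w hw => hw.trans_lt hz) A h1

theorem isPair_moved (H : DeathSwap g g' s t x) : g'.IsPair s t := by
  have hV := H.vectorField_eq
  have hst := H.lt_left.trans H.lt_right
  have hp := (isPair_iff H.birth_crit H.death_crit hst).1 H.isPair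
  have hlt' : g' s < g' t :=
    (H.lt_iff H.birth_crit H.death_crit (by have := H.birth_ne'; have := H.birth_ne; tauto)).1 hst
  have hs1 := H.birth_ne
  have hs2 := H.birth_ne'
  rw [isPair_iff (hV ▸ H.birth_crit) (hV ▸ H.death_crit) hlt', ← hV,
    morseSum_congr (A := {z | g' z ≤ g' s}) (A' := {z | g z ≤ g s})
      (B := {z | g' z < g' t}) (fun z hz => (H.le_iff hz H.birth_crit (by tauto)).symm) (fun z hz => H.lt_death_iff' hz),
    morseSum_congr (A := {z | g' z < g' s}) (A' := {z | g z < g s})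
      (B := {z | g' z < g' t}) (fun z hz => (H.lt_iff hz H.birth_crit (by tauto)).symm) (fun z hz => H.lt_death_iff' hz)]
  constructor
  · have h1 := hp.1
    rw [morseSum_congr (B := {z | g z < g t}) (fun _ _ => Iff.rfl)
      fun z hz => H.lt_death_iff hz] at h1
    rcases mem_morseSum_insert_right h1 with h2 | h2
    · exact h2
    -- It remains to reduce ∂x to s using cells before x. This is clear if x is no death or its
    -- birth precedes s; if its birth b follows s, `unblocked` would make ∂x reducible below b.
    suffices h3 : (fun i => K.bd i x) ∈ morseSum K g.vectorField {z | g z ≤ g s} {z | g z < g x} by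
      have := Submodule.add_mem _ h2 h3
      rwa [sub_add_cancel] at this
    by_cases hx : ∀ b, ¬ g.IsPair b x
    · exact H.column_mem_of_not_death hx _
    push Not at hx
    obtain ⟨b, hb⟩ := hx
    have hbx := hb.lt_of_mem_critCells (Or.inr H.crit)
    have hbc := hb.birth_mem_critCells hbx
    have hb' := (isPair_iff hbc H.crit hbx).1 hb
    rcases _root_.lt_trichotomy (g b) (g s) with h3 | h3 | h3
    · exact morseSum_mono (fun z hz => (show g z ≤ g b from hz.1).trans h3.le)
        Set.inter_subset_left hb'.1
    · rw [eq_of_value_eq H.birth_crit h3] at hb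
      exact absurd (hb.birth_unique H.isPair) H.ne
    · refine absurd ?_ hb'.2
      have h4 := Submodule.sub_mem _ (H.unblocked b hb h3) (morseSum_mono (A' := {z | g z < g b})
        (fun z hz => (show g z ≤ g s from hz.1).trans_lt h3) Set.inter_subset_left h2)
      rwa [sub_sub_cancel] at h4
  · refine fun h1 => hp.2 (morseSum_mono Set.inter_subset_left (fun z hz => ?_) h1)
    exact _root_.lt_trans hz.1 H.lt_right

/-- The new column ∂t must not help to reduce ∂x below b. If it did, ∂t would be reducible below s
when b < s; when s < b, `unblocked` would remove ∂t again. -/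
theorem isPair_swapped (H : DeathSwap g g' s t x) {b : X} (hb : g.IsPair b x) :
    g'.IsPair b x := by
  have hV := H.vectorField_eq
  have hbx := hb.lt_of_mem_critCells (Or.inr H.crit)
  have hbc := hb.birth_mem_critCells hbx
  have hbt : b ≠ t := fun h1 => hb.birth_not_death (h1 ▸ H.isPair)
  have hbx' : b ≠ x := hb.ne
  have hst := H.lt_left.trans H.lt_right
  have hp := (isPair_iff hbc H.crit hbx).1 hb
  have hlt' : g' b < g' x := (H.lt_iff hbc H.crit (by tauto)).1 hbx
  rw [isPair_iff (hV ▸ hbc) (hV ▸ H.crit) hlt', ← hV,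
    morseSum_congr (A := {z | g' z ≤ g' b}) (A' := {z | g z ≤ g b})
      (B := {z | g' z < g' x}) (fun z hz => (H.le_iff hz hbc (by tauto)).symm) (fun z hz => H.lt_swapped_iff hz),
    morseSum_congr (A := {z | g' z < g' b}) (A' := {z | g z < g b})
      (B := {z | g' z < g' x}) (fun z hz => (H.lt_iff hz hbc (by tauto)).symm) (fun z hz => H.lt_swapped_iff hz)]
  constructor
  · exact morseSum_mono Set.inter_subset_left
      (Set.inter_subset_left.trans (Set.subset_insert _ _)) hp.1
  · intro h1
    rcases mem_morseSum_insert_right h1 with h2 | h2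
    · exact hp.2 h2
    rcases _root_.lt_trichotomy (g b) (g s) with h3 | h3 | h3
    · refine ((isPair_iff H.birth_crit H.death_crit hst).1 H.isPair).2 ?_
      have h4 : (fun i => K.bd i x) ∈ morseSum K g.vectorField {z | g z < g s}
          {z | g z < g t} :=
        Submodule.mem_sup_left (Submodule.mem_sup_right
          (column_mem_boundariesOf ⟨H.lt_right, H.crit⟩))
      have h5 := Submodule.sub_mem _ h4 (morseSum_mono (A' := {z | g z < g s})
        (B' := {z | g z < g t}) (fun z hz => _root_.lt_trans hz.1 h3)
        (fun z hz => _root_.lt_trans hz.1 H.lt_right) h2)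
      rwa [sub_sub_cancel] at h5
    · rw [eq_of_value_eq H.birth_crit h3] at hb
      exact H.ne (hb.birth_unique H.isPair)
    · have h4 := Submodule.add_mem _ h2 (H.unblocked b hb h3)
      rw [sub_add_cancel] at h4
      exact hp.2 h4

/-- Old pairs persist, and t and x have only one birth each, so neither acquires another one. If x
was no death, its boundary comes from earlier cells, which still precede it. -/
theorem birthDeath_eq (H : DeathSwap g g' s t x) : g.birthDeath = g'.birthDeath := by
  have hV := H.vectorField_eq
  ext ⟨b, d⟩
  rw [mem_birthDeath, mem_birthDeath]
  change g.IsPair b d ↔ g'.IsPair b d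
  constructor
  · intro hp
    rcases hp.le.lt_or_eq with hlt | he
    swap
    · exact isPair_of_same_vector hV hp he
    by_cases hdt : d = t
    · subst hdt
      rw [hp.death_unique H.isPair]
      exact H.isPair_moved
    by_cases hdx : d = x
    · subst hdx
      exact H.isPair_swapped hp
    have hbt : b ≠ t := fun h1 => hp.birth_not_death (h1 ▸ H.isPair)
    exact (H.isPair_iff_of_ne (hp.birth_mem_critCells hlt) (hp.death_mem_critCells hlt) hlt hbt
      hdx hdt).1 hp
  · intro hp
    rcases hp.le.lt_or_eq with hlt | he
    swap
    · exact isPair_of_same_vector hV.symm hp he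
    by_cases hdt : d = t
    · subst hdt
      rw [hp.death_unique H.isPair_moved]
      exact H.isPair
    have hbt : b ≠ t := fun h1 => hp.birth_not_death (h1 ▸ H.isPair_moved)
    have hbc : b ∈ critCells g.vectorField := hV ▸ hp.birth_mem_critCells hlt
    have hdc : d ∈ critCells g.vectorField := hV ▸ hp.death_mem_critCells hlt
    by_cases hdx : d = x
    · subst hdx
      by_cases hx : ∀ b, ¬ g.IsPair b d
      · refine absurd ?_ ((isPair_iff (hV ▸ hbc) (hV ▸ hdc) hlt).1 hp).2
        rw [← hV, morseSum_congr (B := {z | g' z < g' d}) (fun _ _ => Iff.rfl)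
          fun z hz => H.lt_swapped_iff hz]
        exact morseSum_mono Set.inter_subset_left
          (Set.inter_subset_left.trans (Set.subset_insert _ _)) (H.column_mem_of_not_death hx _)
      · push Not at hx
        obtain ⟨b', hb'⟩ := hx
        rwa [hp.death_unique (H.isPair_swapped hb')]
    have hlt' : g b < g d := by
      rwa [← H.eq_of_ne b hbc hbt, ← H.eq_of_ne d hdc hdt]
    exact (H.isPair_iff_of_ne hbc hdc hlt' hbt hdx hdt).2 hp

end DeathSwap

/-! ### Blocked moves lie in the forbidden region -/

/-- By laziness, a column added to that of y has its low strictly after x, and that low precedes y.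
The level of x and y has no room for a third cell. -/
theorem reduced_column_of_vector {R U : X → X → ZMod 2} (hR : IsLazyReduced h.lt K.bd R U)
    {x y : X} (hxy : h.IsPair x y) (he : h x = h y) : (fun i => R i y) = fun i => K.bd i y := by
  have hlow := (IsPair.isLow hR).2 hxy
  ext i
  rw [hR.decomp, Finset.sum_eq_single y]
  · rw [hR.diag, one_mul]
  · intro w _ hw
    by_contra hne
    obtain ⟨hlt, b, hb, hz⟩ := hR.lower w y hw (left_ne_zero_of_mul hne)
    have h1 : h.lt x b := by
      rcases h.lt_trichotomy x b with h1 | h1 | h1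
      · exact h1
      · exact absurd (hz x (Or.inl h1)) hlow.1
      · exact absurd (hz x (Or.inr h1)) hlow.1
    have h2 : h.lt b w := ((IsPair.isLow hR).1 hb).lt
    have h3 : h.lt b y := lt_trans h2 hlt
    have h4 : h x ≤ h b := h1.elim le_of_lt fun h5 => h5.1.le
    have h5 : h b ≤ h y := h3.elim le_of_lt fun h5 => h5.1.le
    rcases eq_or_eq_of_eq hxy.ne he (by linarith : h b = h x) with rfl | rfl
    · exact h.lt_asymm _ _ h1 h1
    · exact h.lt_asymm _ _ h3 h3
  · simp

/-- The column of t is the sum of the reduced columns x with `U x t = 1`. A summand is harmless if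
its low is below `a`, if x is below `b`, or if it comes from a vector; so some other summand must
occur. -/
theorem exists_related_pair {R U : X → X → ZMod 2} (hR : IsLazyReduced h.lt K.bd R U) {s t : X}
    (hst : h.IsPair s t) {a b : ℝ} (ha : h s < a)
    (hmem : (fun i => K.bd i t) ∉ morseSum K h.vectorField {z | h z < a} {z | h z < b}) :
    ∃ y x, h.IsPair y x ∧ h y < h x ∧ x ≠ t ∧ U x t = 1 ∧ a ≤ h y ∧ b ≤ h x := by
  by_contra! hno
  refine hmem ?_
  have e : (fun i => K.bd i t) = ∑ x, U x t • fun i => R i x := by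
    ext i
    simp only [Finset.sum_apply, Pi.smul_apply, smul_eq_mul]
    exact hR.decomp t i
  rw [e]
  have hA : ∀ z ∈ {z | h z < a}, ∀ w, h w ≤ h z → w ∈ {z | h z < a} :=
    fun z hz w hw => hw.trans_lt hz
  have hB : ∀ z ∈ {z | h z < b}, ∀ w, h w ≤ h z → w ∈ {z | h z < b} :=
    fun z hz w hw => hw.trans_lt hz
  have hlow : ∀ y x, h.IsPair y x → h y < a →
      (fun i => R i x) ∈ morseSum K h.vectorField {z | h z < a} {z | h z < b} := by
    intro y x hp hy
    refine chainsOn_le_morseSum hA _ fun z hz => ((IsPair.isLow hR).2 hp).2 z (Or.inl ?_)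
    exact hy.trans_le (not_lt.1 hz)
  refine Submodule.sum_mem _ fun x _ => ?_
  by_cases h0 : U x t = 0
  · rw [h0, zero_smul]; exact Submodule.zero_mem _
  refine Submodule.smul_mem _ _ ?_
  by_cases hx : x = t
  · subst hx
    exact hlow s x hst ha
  obtain ⟨-, y, hy, -⟩ := hR.lower x t hx h0
  have hp := (IsPair.isLow hR).1 hy
  rcases hp.le.lt_or_eq with hlt | he
  · by_cases hya : h y < a
    · exact hlow y x hp hya
    have hxb := hno y x hp hlt hx (ZMod.two_eq_one_of_ne_zero h0) (not_lt.1 hya)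
    refine boundariesOf_le_morseSum hB _ (boundariesOf_mono (fun z hz => ?_)
      (reduced_column_mem hR x))
    have h1 : h z ≤ h x := not_lt.1 fun h2 => hz (Or.inl h2)
    exact h1.trans_lt hxb
  · rw [reduced_column_of_vector hR hp he]
    exact Submodule.mem_sup_right (Submodule.mem_sup_right (column_mem_boundariesOf
      (mem_upperCells.2 ⟨y, hp.bd_of_eq he, he⟩)))

end DiscreteMorseFunction

/-! ### The dual complex -/

namespace LefschetzComplex

variable {X : Type*} [Fintype X]

theorem dim_le_sup (K : LefschetzComplex X) (x : X) : K.dim x ≤ Finset.univ.sup K.dim :=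
  Finset.le_sup (Finset.mem_univ x)

/-- The complex with the transposed boundary matrix. -/
def dual (K : LefschetzComplex X) : LefschetzComplex X where
  -- The maximal dimension keeps the truncated subtraction exact.
  dim x := Finset.univ.sup K.dim - K.dim x
  bd x y := K.bd y x
  dim_of_bd x y hxy := by
    have h1 := K.dim_of_bd y x hxy
    have h2 := K.dim_le_sup x
    have h3 := K.dim_le_sup y
    omega
  bd_bd x y := by
    rw [← K.bd_bd y x]
    exact Finset.sum_congr rfl fun z _ => mul_comm _ _

end LefschetzComplex

namespace DiscreteMorseFunction

variable {X : Type*} [Fintype X] {K : LefschetzComplex X} (h g g' : DiscreteMorseFunction K)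

/-- The discrete Morse function `-h` on the dual complex. -/
def dual : DiscreteMorseFunction K.dual where
  toFun x := -h x
  mono x y hxy := neg_le_neg (h.mono y x hxy)
  pairing x y hne he := (h.pairing x y hne (neg_injective he)).symm
  almost_injective a := by
    have e : {x | -h x = a} = {x | h x = -a} := by
      ext x
      exact neg_eq_iff_eq_neg
    rw [e]
    exact h.almost_injective (-a)

theorem dual_apply (x : X) : h.dual x = -h x := rfl

theorem dual_lt : h.dual.lt = fun x y => h.lt y x := by
  funext x y
  refine propext (or_congr neg_lt_neg_iff (and_congr (neg_inj.trans eq_comm) ?_))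
  change Finset.univ.sup K.dim - K.dim x < Finset.univ.sup K.dim - K.dim y ↔ K.dim y < K.dim x
  have h2 := K.dim_le_sup x
  have h3 := K.dim_le_sup y
  omega

theorem dual_vectorField : h.dual.vectorField = h.vectorField := by
  ext A
  refine and_congr_right fun _ => ⟨?_, ?_⟩
  · rintro ⟨a, rfl⟩
    refine ⟨-a, ?_⟩
    ext x
    exact neg_eq_iff_eq_neg
  · rintro ⟨a, rfl⟩
    refine ⟨-a, ?_⟩
    ext x
    exact neg_inj.symm

theorem isLazyReduced_dual : IsLazyReduced h.dual.lt K.dual.bd h.cohomReduction.R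
    h.cohomReduction.U := by
  rw [dual_lt]
  exact h.isLazyReduced_cohomReduction

variable {h g g'}

theorem dual_isPair {b d : X} : h.dual.IsPair d b ↔ h.IsPair b d := by
  constructor
  · intro hp
    have := IsPersistencePair.dual h.dual.lt_trichotomy h.dual.lt_asymm hp
    rw [dual_lt] at this
    exact this
  · intro hp
    have := IsPersistencePair.dual h.lt_trichotomy h.lt_asymm hp
    unfold IsPair
    rw [dual_lt]
    exact this

theorem birthDeath_eq_of_dual (he : g.dual.birthDeath = g'.dual.birthDeath) :
    g.birthDeath = g'.birthDeath := by
  ext ⟨b, d⟩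
  have h1 := Set.ext_iff.1 he (d, b)
  rwa [mem_birthDeath, mem_birthDeath, dual_isPair, dual_isPair, ← mem_birthDeath (p := (b, d)),
    ← mem_birthDeath (p := (b, d))] at h1

/-! ### Forbidden regions -/

theorem mem_offDiagonal {b d : X} : (b, d) ∈ h.offDiagonal ↔ h.IsPair b d ∧ h b < h d :=
  and_congr_left fun _ => h.mem_birthDeath

theorem mem_deathForbidden_of_path {s t x : X} (hx : x ∈ critCells h.vectorField)
    (hp : HasPath K h.vectorField t x) {p : EReal × EReal} (h1 : p.1 ≤ (h x : EReal))
    (h2 : p.2 ≤ (h x : EReal)) : p ∈ h.deathForbidden (s, t) := by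
  refine Or.inr ?_
  simp only [Set.mem_iUnion]
  exact ⟨x, ⟨hx, hp⟩, ⟨bot_le, h1⟩, ⟨bot_le, h2⟩⟩

theorem mem_birthForbidden_of_path {s t x : X} (hx : x ∈ critCells h.vectorField)
    (hp : HasPath K h.vectorField x s) {p : EReal × EReal} (h1 : (h x : EReal) ≤ p.1)
    (h2 : (h x : EReal) ≤ p.2) : p ∈ h.birthForbidden (s, t) := by
  refine Or.inr ?_
  simp only [Set.mem_iUnion]
  exact ⟨x, ⟨hx, hp⟩, ⟨h1, le_top⟩, ⟨h2, le_top⟩⟩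

theorem mem_deathForbidden_of_not_mem {s t : X} (hst : h.IsPair s t) {a b : ℝ} (ha : h s < a)
    (hmem : (fun i => K.bd i t) ∉ morseSum K h.vectorField {z | h z < a} {z | h z < b})
    {p : EReal × EReal} (h1 : p.1 ≤ (a : EReal)) (h2 : p.2 ≤ (b : EReal)) :
    p ∈ h.deathForbidden (s, t) := by
  have hR := h.isLazyReduced_homReduction
  obtain ⟨y, x, hyx, hlt, hne, hU, hy, hx⟩ := exists_related_pair hR hst ha hmem
  refine Or.inl ?_
  simp only [Set.mem_iUnion]
  have hdim : K.dim x = K.dim t :=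
    (hR.homogeneous K.dim K.dim_of_bd).2 x t (by rw [hU]; exact one_ne_zero)
  refine ⟨(y, x), ⟨mem_offDiagonal.2 ⟨hyx, hlt⟩, ?_, Or.inr ⟨hdim, hne, hU⟩⟩,
    ⟨bot_le, h1.trans (EReal.coe_le_coe_iff.2 hy)⟩,
    ⟨bot_le, h2.trans (EReal.coe_le_coe_iff.2 hx)⟩⟩
  have h3 := hyx.dim
  have h4 := hst.dim
  change K.dim y = K.dim s
  omega

theorem mem_birthForbidden_of_not_mem {s t : X} (hst : h.IsPair s t) {a b : ℝ}
    (hb : b < h t)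
    (hmem : (fun i => K.dual.bd i s) ∉
      morseSum K.dual h.dual.vectorField {z | h.dual z < -b} {z | h.dual z < -a})
    {p : EReal × EReal} (h1 : (a : EReal) ≤ p.1) (h2 : (b : EReal) ≤ p.2) :
    p ∈ h.birthForbidden (s, t) := by
  have hR := h.isLazyReduced_dual
  obtain ⟨x, y, hxy, hlt, hne, hU, hx, hy⟩ := exists_related_pair hR (dual_isPair.2 hst)
    (neg_lt_neg hb) hmem
  have hyx := dual_isPair.1 hxy
  rw [dual_apply, dual_apply, neg_lt_neg_iff] at hlt
  rw [dual_apply, neg_le_neg_iff] at hx hy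
  refine Or.inl ?_
  simp only [Set.mem_iUnion]
  have hdim : K.dual.dim y = K.dual.dim s :=
    (hR.homogeneous K.dual.dim K.dual.dim_of_bd).2 y s (by rw [hU]; exact one_ne_zero)
  have hdim' : K.dim y = K.dim s := by
    have h3 := K.dim_le_sup y
    have h4 := K.dim_le_sup s
    change Finset.univ.sup K.dim - K.dim y = Finset.univ.sup K.dim - K.dim s at hdim
    omega
  exact ⟨(y, x), ⟨mem_offDiagonal.2 ⟨hyx, hlt⟩, hdim', Or.inl ⟨hdim', hne, hU⟩⟩,
    ⟨(EReal.coe_le_coe_iff.2 hy).trans h1, le_top⟩,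
    ⟨(EReal.coe_le_coe_iff.2 hx).trans h2, le_top⟩⟩

end DiscreteMorseFunction

/-! ### Extension of functions from the critical cells -/

/-- A strictly monotone injective function on a finite set extends to one more point. -/
theorem exists_extension_step {P : Type*} [Finite P] (r : P → P → Prop)
    (hirr : ∀ p, ¬ r p p) (htr : ∀ p q s, r p q → r q s → r p s) (S : Set P) (f : P → ℝ)
    (hinj : Set.InjOn f S) (hf : ∀ p ∈ S, ∀ q ∈ S, r p q → f p < f q) (a : P) (ha : a ∉ S) :
    ∃ f' : P → ℝ, Set.EqOn f' f S ∧ Set.InjOn f' (insert a S) ∧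
      ∀ p ∈ insert a S, ∀ q ∈ insert a S, r p q → f' p < f' q := by
  classical
  obtain ⟨lo, hlo1, hlo2⟩ : ∃ lo : ℝ, (∀ p ∈ S, r p a → f p ≤ lo) ∧
      ∀ q ∈ S, r a q → lo < f q := by
    by_cases hne : {p | p ∈ S ∧ r p a}.Nonempty
    · obtain ⟨m, hm, hmax⟩ := (Set.toFinite {p | p ∈ S ∧ r p a}).exists_maximalFor f _ hne
      refine ⟨f m, fun p hp hpa => ?_, fun q hq hqa => hf m hm.1 q hq (htr _ _ _ hm.2 hqa)⟩
      by_contra hlt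
      exact hlt (hmax (j := p) ⟨hp, hpa⟩ (le_of_lt (not_le.1 hlt)))
    · by_cases hne' : {q | q ∈ S ∧ r a q}.Nonempty
      · obtain ⟨m, hm, hmin⟩ := (Set.toFinite {q | q ∈ S ∧ r a q}).exists_minimalFor f _ hne'
        refine ⟨f m - 1, fun p hp hpa => absurd ⟨p, hp, hpa⟩ hne, fun q hq hqa => ?_⟩
        have : f m ≤ f q := by
          by_contra hlt
          exact hlt (hmin (j := q) ⟨hq, hqa⟩ (le_of_lt (not_le.1 hlt)))
        linarith
      · exact ⟨0, fun p hp hpa => absurd ⟨p, hp, hpa⟩ hne,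
          fun q hq hqa => absurd ⟨q, hq, hqa⟩ hne'⟩
  obtain ⟨hi, hhi1, hhi2⟩ : ∃ hi : ℝ, lo < hi ∧ ∀ q ∈ S, r a q → hi ≤ f q := by
    by_cases hne' : {q | q ∈ S ∧ r a q}.Nonempty
    · obtain ⟨m, hm, hmin⟩ := (Set.toFinite {q | q ∈ S ∧ r a q}).exists_minimalFor f _ hne'
      refine ⟨f m, hlo2 m hm.1 hm.2, fun q hq hqa => ?_⟩
      by_contra hlt
      exact hlt (hmin (j := q) ⟨hq, hqa⟩ (le_of_lt (not_le.1 hlt)))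
    · exact ⟨lo + 1, by linarith, fun q hq hqa => absurd ⟨q, hq, hqa⟩ hne'⟩
  obtain ⟨v, ⟨hv1, hv2⟩, hv3⟩ := (Set.Ioo_infinite hhi1).exists_notMem_finite (Set.toFinite (f '' S))
  have hv4 : ∀ p ∈ S, f p ≠ v := fun p hp he => hv3 ⟨p, hp, he⟩
  have hS : ∀ p ∈ S, Function.update f a v p = f p := fun p hp =>
    Function.update_of_ne (ne_of_mem_of_not_mem hp ha) _ _
  refine ⟨Function.update f a v, hS, ?_, ?_⟩
  · rintro p (rfl | hp) q (rfl | hq) he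
    · rfl
    · rw [Function.update_self, hS q hq] at he
      exact absurd he.symm (hv4 q hq)
    · rw [Function.update_self, hS p hp] at he
      exact absurd he (hv4 p hp)
    · rw [hS p hp, hS q hq] at he
      exact hinj hp hq he
  · rintro p (rfl | hp) q (rfl | hq) hr
    · exact absurd hr (hirr _)
    · rw [Function.update_self, hS q hq]
      exact hv2.trans_le (hhi2 q hq hr)
    · rw [Function.update_self, hS p hp]
      exact (hlo1 p hp hr).trans_lt hv1
    · rw [hS p hp, hS q hq]
      exact hf p hp q hq hr

theorem exists_extension {P : Type*} [Finite P] (r : P → P → Prop)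
    (hirr : ∀ p, ¬ r p p) (htr : ∀ p q s, r p q → r q s → r p s) (S : Set P) (f : P → ℝ)
    (hinj : Set.InjOn f S) (hf : ∀ p ∈ S, ∀ q ∈ S, r p q → f p < f q) :
    ∃ f' : P → ℝ, Set.EqOn f' f S ∧ Function.Injective f' ∧ ∀ p q, r p q → f' p < f' q := by
  obtain ⟨T, ⟨f', he, hinj', hf'⟩, hmax⟩ := (Set.toFinite {T : Set P | ∃ f' : P → ℝ,
    Set.EqOn f' f S ∧ Set.InjOn f' (T ∪ S) ∧
      ∀ p ∈ T ∪ S, ∀ q ∈ T ∪ S, r p q → f' p < f' q}).exists_maximal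
      ⟨∅, f, fun _ _ => rfl, by simpa using hinj, by simpa using hf⟩
  have hT : ∀ p, p ∈ T ∪ S := by
    intro a
    by_contra ha
    obtain ⟨f'', h1, h2, h3⟩ := exists_extension_step r hirr htr (T ∪ S) f' hinj' hf' a ha
    rw [← Set.insert_union] at h2 h3
    have h4 := hmax (y := insert a T)
      ⟨f'', fun p hp => (h1 (Or.inr hp)).trans (he hp), h2, h3⟩ (Set.subset_insert _ _)
    exact ha (Or.inl (h4 (Set.mem_insert _ _)))
  exact ⟨f', he, fun p q hpq => hinj' (hT p) (hT q) hpq, fun p q => hf' p (hT p) q (hT q)⟩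

namespace DiscreteMorseFunction

variable {X : Type*} [Fintype X] {K : LefschetzComplex X} {g : DiscreteMorseFunction K}

theorem le_of_arc {x y : X} (ha : Arc K g.vectorField x y) : g y ≤ g x := by
  rcases ha with ⟨h1, h2⟩ | ⟨h1, h2⟩
  · exact ((pair_mem_vectorField (LefschetzComplex.ne_of_bd h1)).1 h2).ge
  · exact g.mono y x h1

theorem lt_of_path {x y : X} (hx : x ∈ critCells g.vectorField)
    (hp : HasPath K g.vectorField x y) : g y < g x := by
  have hle : ∀ {z w}, Relation.ReflTransGen (Arc K g.vectorField) z w → g w ≤ g z := by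
    intro z w hzw
    induction hzw with
    | refl => exact le_rfl
    | tail _ h1 ih => exact (le_of_arc h1).trans ih
  obtain ⟨z, h1, h2⟩ := Relation.TransGen.head'_iff.1 hp
  refine (hle h2).trans_lt (lt_of_le_of_ne (le_of_arc h1) fun he => ?_)
  have := eq_of_value_eq hx he
  subst this
  rcases h1 with ⟨h1, -⟩ | ⟨h1, -⟩ <;> exact LefschetzComplex.ne_of_bd h1 rfl

/-- One level is reached from another through a facet. -/
def LevelStep (g : DiscreteMorseFunction K) (p q : Set.range g.toFun) : Prop :=
  ∃ x y, g x = p ∧ g y = q ∧ K.bd x y = 1 ∧ g x < g y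

/-- The facet relation concerns one cell y of the level, but the path may have to start at its
partner v. If v is the lower cell, the explicit arc leads to y. -/
theorem hasPath_of_levelStep {p q : Set.range g.toFun} (hpq : g.LevelStep p q) {v : X}
    (hv : g v = q) : ∃ u, g u = p ∧ HasPath K g.vectorField v u := by
  obtain ⟨x, y, hx, hy, hxy, hlt⟩ := hpq
  have harc : ∀ {z w : X}, K.bd z w = 1 → g z ≠ g w → Arc K g.vectorField w z := by
    refine fun {z w} h1 h2 => Or.inr ⟨h1, ?_⟩
    rw [pair_mem_vectorField (LefschetzComplex.ne_of_bd h1).symm]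
    exact fun e => h2 e.symm
  by_cases hvy : v = y
  · subst hvy
    exact ⟨x, hx, Relation.TransGen.single (harc hxy hlt.ne)⟩
  rcases g.pairing v y hvy (hv.trans hy.symm) with h1 | h1
  · have h2 : Arc K g.vectorField v y :=
      Or.inl ⟨h1, (pair_mem_vectorField hvy).2 (hv.trans hy.symm)⟩
    exact ⟨x, hx, (Relation.TransGen.single h2).tail (harc hxy hlt.ne)⟩
  -- If v is the upper cell, ∂∂ = 0 supplies a second cell z between x and v. The path runs through
  -- z, or stops there if z and x share a level.
  · have hsum := K.bd_bd x v
    obtain ⟨z, hzy, hz⟩ : ∃ z, z ≠ y ∧ K.bd x z * K.bd z v ≠ 0 := by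
      by_contra! hno
      rw [Finset.sum_eq_single y (fun z _ hz => hno z hz) (by simp), hxy, h1] at hsum
      exact absurd hsum (by decide)
    have hxz := ZMod.two_eq_one_of_ne_zero (left_ne_zero_of_mul hz)
    have hzv := ZMod.two_eq_one_of_ne_zero (right_ne_zero_of_mul hz)
    have hne : g z ≠ g v := fun he => by
      rcases eq_or_eq_of_eq hvy (hv.trans hy.symm) he with rfl | h2
      · exact LefschetzComplex.ne_of_bd hzv rfl
      · exact hzy h2
    by_cases he : g x = g z
    · exact ⟨z, he.symm.trans hx, Relation.TransGen.single (harc hzv hne)⟩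
    · exact ⟨x, hx, (Relation.TransGen.single (harc hzv hne)).tail (harc hxz he)⟩

/-- Values on the critical cells which decrease along paths extend to a discrete Morse function
with the same vector field. -/
theorem exists_of_values (f : X → ℝ) (hinj : Set.InjOn f (critCells g.vectorField))
    (hf : ∀ x ∈ critCells g.vectorField, ∀ y ∈ critCells g.vectorField,
      HasPath K g.vectorField x y → f y < f x) :
    ∃ g' : DiscreteMorseFunction K, g.vectorField = g'.vectorField ∧
      ∀ x ∈ critCells g.vectorField, g' x = f x := by
  have hlt : ∀ {p q}, Relation.TransGen g.LevelStep p q → (p : ℝ) < q := by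
    intro p q hpq
    induction hpq with
    | single h1 =>
      obtain ⟨x, y, hx, hy, -, h2⟩ := h1
      rwa [hx, hy] at h2
    | tail _ h1 ih =>
      obtain ⟨x, y, hx, hy, -, h2⟩ := h1
      rw [hx, hy] at h2
      exact ih.trans h2
  have hpath : ∀ {p q}, Relation.TransGen g.LevelStep p q → ∀ v, g v = q →
      ∃ u, g u = p ∧ HasPath K g.vectorField v u := by
    intro p q hpq
    induction hpq using Relation.TransGen.head_induction_on with
    | single h1 => exact fun v hv => hasPath_of_levelStep h1 hv
    | head h1 _ ih =>
      intro v hv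
      obtain ⟨u, hu, h2⟩ := ih v hv
      obtain ⟨w, hw, h3⟩ := hasPath_of_levelStep h1 hu
      exact ⟨w, hw, h2.trans h3⟩
  -- The extension takes place on the set of levels: an injective function of the level has exactly
  -- the same level sets.
  let ρ : X → Set.range g.toFun := fun x => ⟨g x, x, rfl⟩
  let σ : Set.range g.toFun → X := fun p => p.2.choose
  have hσ : ∀ p, g (σ p) = p := fun p => p.2.choose_spec
  have hσρ : ∀ x ∈ critCells g.vectorField, σ (ρ x) = x := fun x hx =>
    eq_of_value_eq hx (hσ (ρ x))
  obtain ⟨φ, h1, h2, h3⟩ := exists_extension (Relation.TransGen g.LevelStep)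
    (fun p hp => lt_irrefl _ (hlt hp)) (fun _ _ _ => Relation.TransGen.trans)
    (ρ '' critCells g.vectorField) (f ∘ σ)
    (by
      rintro _ ⟨x, hx, rfl⟩ _ ⟨y, hy, rfl⟩ he
      simp only [Function.comp_apply, hσρ x hx, hσρ y hy] at he
      rw [hinj hx hy he])
    (by
      rintro _ ⟨x, hx, rfl⟩ _ ⟨y, hy, rfl⟩ hr
      simp only [Function.comp_apply, hσρ x hx, hσρ y hy]
      obtain ⟨u, hu, h4⟩ := hpath hr y rfl
      rw [eq_of_value_eq hx hu] at h4
      exact hf y hy x hx h4)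
  have heq : ∀ x y, φ (ρ x) = φ (ρ y) ↔ g x = g y := fun x y =>
    h2.eq_iff.trans Subtype.ext_iff
  let g' : DiscreteMorseFunction K :=
    { toFun := fun x => φ (ρ x)
      mono := fun x y hxy => by
        rcases (g.mono x y hxy).lt_or_eq with h4 | h4
        · exact (h3 _ _ (Relation.TransGen.single ⟨x, y, rfl, rfl, hxy, h4⟩)).le
        · exact ((heq x y).2 h4).le
      pairing := fun x y hne he => g.pairing x y hne ((heq x y).1 he)
      almost_injective := fun a => by
        by_cases hne : {x | φ (ρ x) = a}.Nonempty
        · obtain ⟨x, rfl⟩ := hne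
          have e : {y | φ (ρ y) = φ (ρ x)} = {y | g y = g x} := by
            ext y
            exact heq y x
          rw [e]
          exact g.almost_injective _
        · rw [Set.not_nonempty_iff_eq_empty.1 hne]
          simp }
  refine ⟨g', ?_, fun x hx => ?_⟩
  · ext A
    refine and_congr_right fun hA => ⟨?_, ?_⟩
    · rintro ⟨a, rfl⟩
      obtain ⟨x, rfl⟩ := hA
      refine ⟨g' x, ?_⟩
      ext y
      exact (heq y x).symm
    · rintro ⟨a, rfl⟩
      obtain ⟨x, rfl⟩ := hA
      refine ⟨g x, ?_⟩
      ext y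
      exact heq y x
  · change φ (ρ x) = f x
    rw [h1 ⟨x, hx, rfl⟩, Function.comp_apply, hσρ x hx]

end DiscreteMorseFunction

namespace DiscreteMorseFunction

variable {X : Type*} [Fintype X] {K : LefschetzComplex X} {h g g' : DiscreteMorseFunction K}

/-! ### Moving a component of a pair -/

/-- The value of a single critical cell can be changed as long as paths still descend. -/
theorem exists_move {c : X} (hc : c ∈ critCells g.vectorField) {v : ℝ}
    (hval : ∀ z ∈ critCells g.vectorField, z ≠ c → g z ≠ v)
    (hfrom : ∀ z ∈ critCells g.vectorField, z ≠ c → HasPath K g.vectorField c z → g z < v)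
    (hto : ∀ z ∈ critCells g.vectorField, z ≠ c → HasPath K g.vectorField z c → v < g z) :
    ∃ g' : DiscreteMorseFunction K, g.vectorField = g'.vectorField ∧ g' c = v ∧
      ∀ z ∈ critCells g.vectorField, z ≠ c → g' z = g z := by
  classical
  have hne : ∀ z, z ≠ c → Function.update g.toFun c v z = g z := fun z hz =>
    Function.update_of_ne hz _ _
  obtain ⟨g', hV, hg'⟩ := exists_of_values (g := g) (Function.update g.toFun c v)
    (fun x hx y hy he => by
      by_cases hxc : x = c <;> by_cases hyc : y = c
      · rw [hxc, hyc]
      · rw [hxc, Function.update_self, hne y hyc] at he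
        exact absurd he.symm (hval y hy hyc)
      · rw [hyc, Function.update_self, hne x hxc] at he
        exact absurd he (hval x hx hxc)
      · rw [hne x hxc, hne y hyc] at he
        exact eq_of_value_eq hy he)
    (fun x hx y hy hp => by
      by_cases hxc : x = c <;> by_cases hyc : y = c
      · subst hxc; subst hyc
        exact absurd (lt_of_path hx hp) (lt_irrefl _)
      · subst hxc
        rw [Function.update_self, hne y hyc]
        exact hfrom y hy hyc hp
      · subst hyc
        rw [Function.update_self, hne x hxc]
        exact hto x hx hxc hp
      · rw [hne x hxc, hne y hyc]
        exact lt_of_path hx hp)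
  exact ⟨g', hV, by rw [hg' c hc, Function.update_self], fun z hz hzc => by
    rw [hg' z hz, hne z hzc]⟩

theorem atMostOneTransposition_of_lt_iff (hV : g.vectorField = g'.vectorField) (a b : X)
    (hlt : ∀ z ∈ critCells g.vectorField, ∀ w ∈ critCells g.vectorField,
      ¬ (z = a ∧ w = b ∨ z = b ∧ w = a) → (g z < g w ↔ g' z < g' w)) :
    AtMostOneTransposition g g' (critCells g.vectorField) := by
  refine ⟨a, b, fun z hz w hw hne => ?_⟩
  rw [lt_iff_of_mem_critCells_left hz, lt_iff_of_mem_critCells_left (hV ▸ hz)]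
  exact hlt z hz w hw hne

theorem isAllowedMove_of_death {s t : X} (hst : g.IsPair s t) (hlt : g s < g t)
    (hV : g.vectorField = g'.vectorField)
    (heq : ∀ z ∈ critCells g.vectorField, z ≠ t → g' z = g z) (hdec : g' t < g t)
    (htr : AtMostOneTransposition g g' (critCells g.vectorField))
    (hbd : g.birthDeath = g'.birthDeath) : g.IsAllowedMove (s, t) g' :=
  ⟨⟨t, mem_offDiagonal.2 ⟨hst, hlt⟩, Or.inr rfl, hV, fun z hz hzt => (heq z hz hzt).symm,
    fun e => absurd e.symm hst.ne, fun _ => hdec, htr⟩, hbd⟩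

theorem isAllowedMove_of_birth {s t : X} (hst : g.IsPair s t) (hlt : g s < g t)
    (hV : g.vectorField = g'.vectorField)
    (heq : ∀ z ∈ critCells g.vectorField, z ≠ s → g' z = g z) (hinc : g s < g' s)
    (htr : AtMostOneTransposition g g' (critCells g.vectorField))
    (hbd : g.birthDeath = g'.birthDeath) : g.IsAllowedMove (s, t) g' :=
  ⟨⟨s, mem_offDiagonal.2 ⟨hst, hlt⟩, Or.inl rfl, hV, fun z hz hzt => (heq z hz hzt).symm,
    fun _ => hinc, fun e => absurd e hst.ne, htr⟩, hbd⟩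

theorem exists_death_swap {s t x : X} (hst : g.IsPair s t) (hx : x ∈ critCells g.vectorField)
    (hsx : g s < g x) (hxt : g x < g t)
    (hmax : ∀ z ∈ critCells g.vectorField, g z < g t → g z ≤ g x)
    (hpath : ¬ HasPath K g.vectorField t x)
    (hun : ∀ b, g.IsPair b x → g s < g b →
      (fun i => K.bd i t) ∈ morseSum K g.vectorField {z | g z < g b} {z | g z < g x}) :
    ∃ g' : DiscreteMorseFunction K, g.IsAllowedMove (s, t) g' ∧ g s < g' t ∧ g' t < g x ∧
      ∀ z ∈ critCells g.vectorField, z ≠ t → g' z = g z := by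
  have hlt := hsx.trans hxt
  have htc := hst.death_mem_critCells hlt
  obtain ⟨m, hm, hmm⟩ := (Set.toFinite {z | g z < g x}).exists_maximalFor g.toFun _ ⟨s, hsx⟩
  -- The new value of t lies just below x and above every value below x, so that t passes only x.
  obtain ⟨v, hv1, hv2⟩ := exists_between (show g m < g x from hm)
  have hv : ∀ z, g z < g x → g z < v := fun z hz => by
    by_contra hlt
    have h1 := hmm (j := z) hz (hv1.le.trans (not_lt.1 hlt))
    exact hlt (h1.trans_lt hv1)
  have hbelow : ∀ z ∈ critCells g.vectorField, z ≠ x → g z < g t → g z < v :=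
    fun z hz hzx h1 => hv z (lt_of_le_of_ne (hmax z hz h1) fun e => hzx (eq_of_value_eq hx e))
  obtain ⟨g', hV, hg't, heq⟩ := exists_move htc (v := v)
    (fun z hz hzt he => by
      by_cases hzx : z = x
      · subst hzx; exact hv2.ne' he
      · exact (hbelow z hz hzx (he ▸ hv2.trans hxt)).ne he)
    (fun z hz _ hp => hbelow z hz (fun e => hpath (e ▸ hp)) (lt_of_path htc hp))
    (fun z hz _ hp => (hv2.trans hxt).trans (lt_of_path hz hp))
  have H : DeathSwap g g' s t x :=
    { vectorField_eq := hV
      isPair := hst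
      crit := hx
      lt_left := hsx
      lt_right := hxt
      eq_of_ne := heq
      below := hg't ▸ hv2
      adjacent := fun z hz hzx h1 => hg't ▸ hbelow z hz hzx h1
      unblocked := hun }
  refine ⟨g', isAllowedMove_of_death hst hlt hV heq (hg't ▸ hv2.trans hxt)
    (atMostOneTransposition_of_lt_iff hV x t fun z hz w hw => H.lt_iff hz hw) H.birthDeath_eq,
    hg't ▸ hv s hsx, hg't ▸ hv2, heq⟩

theorem exists_birth_swap {s t y : X} (hst : g.IsPair s t) (hy : y ∈ critCells g.vectorField)
    (hsy : g s < g y) (hyt : g y < g t)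
    (hmin : ∀ z ∈ critCells g.vectorField, g s < g z → g y ≤ g z)
    (hpath : ¬ HasPath K g.vectorField y s)
    (hun : ∀ d, g.IsPair y d → g d < g t →
      (fun i => K.dual.bd i s) ∈ morseSum K.dual g.dual.vectorField
        {z | g.dual z < g.dual d} {z | g.dual z < g.dual y}) :
    ∃ g' : DiscreteMorseFunction K, g.IsAllowedMove (s, t) g' ∧ g' s < g t ∧ g y < g' s ∧
      ∀ z ∈ critCells g.vectorField, z ≠ s → g' z = g z := by
  have hlt := hsy.trans hyt
  have hsc := hst.birth_mem_critCells hlt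
  obtain ⟨m, hm, hmm⟩ := (Set.toFinite {z | g y < g z}).exists_minimalFor g.toFun _ ⟨t, hyt⟩
  obtain ⟨v, hv1, hv2⟩ := exists_between (show g y < g m from hm)
  have hv : ∀ z, g y < g z → v < g z := fun z hz => by
    by_contra hlt
    have h1 := hmm (j := z) hz ((not_lt.1 hlt).trans hv2.le)
    exact hlt (hv2.trans_le h1)
  have habove : ∀ z ∈ critCells g.vectorField, z ≠ y → g s < g z → v < g z :=
    fun z hz hzy h1 =>
      hv z (lt_of_le_of_ne (hmin z hz h1) fun e => hzy (eq_of_value_eq hy e.symm))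
  obtain ⟨g', hV, hg's, heq⟩ := exists_move hsc (v := v)
    (fun z hz hzt he => by
      by_cases hzy : z = y
      · subst hzy; exact hv1.ne he
      · exact (habove z hz hzy (he ▸ hsy.trans hv1)).ne' he)
    (fun z hz _ hp => (lt_of_path hsc hp).trans (hsy.trans hv1))
    (fun z hz _ hp => habove z hz (fun e => hpath (e ▸ hp)) (lt_of_path hz hp))
  -- For -g on the dual complex, s is the death of the pair (t, s) and moves below y.
  have H : DeathSwap g.dual g'.dual t s y :=
    { vectorField_eq := by rw [dual_vectorField, dual_vectorField, hV]
      isPair := dual_isPair.2 hst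
      crit := by rwa [dual_vectorField]
      lt_left := neg_lt_neg hyt
      lt_right := neg_lt_neg hsy
      eq_of_ne := fun z hz hzs => by
        rw [dual_vectorField] at hz
        exact congrArg Neg.neg (heq z hz hzs)
      below := neg_lt_neg (hg's ▸ hv1)
      adjacent := fun z hz hzy h1 => by
        rw [dual_vectorField] at hz
        exact neg_lt_neg (hg's ▸ habove z hz hzy (neg_lt_neg_iff.1 h1))
      unblocked := fun d hd h1 => hun d (dual_isPair.1 hd) (neg_lt_neg_iff.1 h1) }
  refine ⟨g', isAllowedMove_of_birth hst hlt hV heq (hg's ▸ hsy.trans hv1)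
    (atMostOneTransposition_of_lt_iff hV s y fun z hz w hw hne => ?_)
    (birthDeath_eq_of_dual H.birthDeath_eq), hg's ▸ hv t hyt, hg's ▸ hv1, heq⟩
  have h1 := H.lt_iff (z := w) (w := z) (by rwa [dual_vectorField]) (by rwa [dual_vectorField])
    (by tauto)
  simpa only [dual_apply, neg_lt_neg_iff] using h1

/-- With no critical cell in between, lowering t leaves the order of the critical cells and hence
all pairs unchanged. -/
theorem exists_shrink {s t : X} (hst : g.IsPair s t) (hlt : g s < g t)
    (hno : ∀ z ∈ critCells g.vectorField, g z < g t → g z ≤ g s) {ε : ℝ} (hε : 0 < ε) :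
    ∃ g' : DiscreteMorseFunction K, g.IsAllowedMove (s, t) g' ∧ 0 < g' t - g' s ∧
      g' t - g' s < ε := by
  have htc := hst.death_mem_critCells hlt
  have hsc := hst.birth_mem_critCells hlt
  obtain ⟨v, hv1, hv2⟩ := exists_between (show g s < min (g t) (g s + ε) from
    lt_min hlt (by linarith))
  obtain ⟨hv3, hv4⟩ := lt_min_iff.1 hv2
  obtain ⟨g', hV, hg't, heq⟩ := exists_move htc (v := v)
    (fun z hz hzt he => absurd (hno z hz (he ▸ hv3)) (not_le.2 (he ▸ hv1)))
    (fun z hz _ hp => (hno z hz (lt_of_path htc hp)).trans_lt hv1)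
    (fun z hz _ hp => hv3.trans (lt_of_path hz hp))
  have hord : ∀ z ∈ critCells g.vectorField, ∀ w ∈ critCells g.vectorField,
      (g z < g w ↔ g' z < g' w) := by
    intro z hz w hw
    by_cases hzt : z = t <;> by_cases hwt : w = t
    · simp [hzt, hwt]
    · subst hzt
      rw [hg't, heq w hw hwt]
      refine ⟨hv3.trans, fun h1 => ?_⟩
      by_contra h2
      have h3 := hno w hw (lt_of_le_of_ne (not_lt.1 h2) fun e => hwt (eq_of_value_eq htc e))
      linarith
    · subst hwt
      rw [hg't, heq z hz hzt]
      exact ⟨fun h1 => (hno z hz h1).trans_lt hv1, fun h1 => h1.trans hv3⟩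
    · rw [heq z hz hzt, heq w hw hwt]
  have hs := heq s hsc hst.ne
  refine ⟨g', isAllowedMove_of_death hst hlt hV heq (hg't ▸ hv3)
    (atMostOneTransposition_of_lt_iff hV s t fun z hz w hw _ => hord z hz w hw)
    (birthDeath_eq_of_lt_iff hV hord), ?_, ?_⟩
  · rw [hg't, hs]; linarith
  · rw [hg't, hs]; linarith

/-! ### The iteration -/

/-- `g` arises from `h` by moving the components of `(s, t)` towards each other. -/
structure Contracts (h g : DiscreteMorseFunction K) (s t : X) : Prop where
  vectorField_eq : g.vectorField = h.vectorField
  birthDeath_eq : g.birthDeath = h.birthDeath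
  eq_of_ne : ∀ z ∈ critCells h.vectorField, z ≠ s → z ≠ t → g z = h z
  birth_le : h s ≤ g s
  le_death : g t ≤ h t
  lt : g s < g t

namespace Contracts

variable {s t : X}

theorem isPair (H : Contracts h g s t) {b d : X} : g.IsPair b d ↔ h.IsPair b d := by
  rw [← mem_birthDeath (p := (b, d)), ← mem_birthDeath (p := (b, d)), H.birthDeath_eq]

theorem eq_of_between (H : Contracts h g s t) {w : X} (hw : w ∈ critCells h.vectorField)
    (h1 : g s < g w) (h2 : g w < g t) : g w = h w := by
  refine H.eq_of_ne w hw ?_ ?_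
  · rintro rfl; exact lt_irrefl _ h1
  · rintro rfl; exact lt_irrefl _ h2

/-- Only s and t have moved, and neither has passed w: s is below w and t above it for both
functions. Thus the conditions at w are the same for `g` and `h`. -/
theorem lt_iff_left (H : Contracts h g s t) {w : X} (hw : w ∈ critCells h.vectorField)
    (h1 : g s < g w) (h2 : g w < g t) {z : X} (hz : z ∈ critCells h.vectorField) :
    g z < g w ↔ h z < h w := by
  have hb := H.birth_le
  have hd := H.le_death
  have e := H.eq_of_between hw h1 h2
  rw [← e]
  by_cases hzs : z = s
  · rw [hzs]
    exact ⟨fun _ => hb.trans_lt h1, fun _ => h1⟩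
  by_cases hzt : z = t
  · rw [hzt]
    exact ⟨fun h3 => absurd h3 h2.not_gt, fun h3 => absurd (hd.trans_lt h3) h2.not_gt⟩
  rw [H.eq_of_ne z hz hzs hzt]

theorem lt_iff_right (H : Contracts h g s t) {w : X} (hw : w ∈ critCells h.vectorField)
    (h1 : g s < g w) (h2 : g w < g t) {z : X} (hz : z ∈ critCells h.vectorField) :
    g w < g z ↔ h w < h z := by
  have hb := H.birth_le
  have hd := H.le_death
  have e := H.eq_of_between hw h1 h2
  rw [← e]
  by_cases hzs : z = s
  · rw [hzs]
    exact ⟨fun h3 => absurd h3 h1.not_gt, fun h3 => absurd (h3.trans_le hb) h1.not_gt⟩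
  by_cases hzt : z = t
  · rw [hzt]
    exact ⟨fun _ => h2.trans_le hd, fun _ => h2⟩
  rw [H.eq_of_ne z hz hzs hzt]

/-- An obstruction to moving the death below `x` comes from the forbidden region of `h`. -/
theorem death_blocked (H : Contracts h g s t) (hst : h.IsPair s t) {x : X}
    (hx : x ∈ critCells h.vectorField) (hsx : g s < g x) (hxt : g x < g t)
    (hbl : HasPath K g.vectorField t x ∨ ∃ b, g.IsPair b x ∧ g s < g b ∧
      (fun i => K.bd i t) ∉ morseSum K g.vectorField {z | g z < g b} {z | g z < g x}) :
    ∃ w ∈ critCells h.vectorField, g s < g w ∧ g w ≤ g x ∧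
      ∀ p : EReal × EReal, p.1 ≤ (h w : EReal) → p.2 ≤ (h x : EReal) →
        p ∈ h.deathForbidden (s, t) := by
  rcases hbl with hp | ⟨b, hb, hsb, hmem⟩
  · rw [H.vectorField_eq] at hp
    exact ⟨x, hx, hsx, le_rfl, fun p h1 h2 => mem_deathForbidden_of_path hx hp h1 h2⟩
  · have hbx := hb.lt_of_mem_critCells (Or.inr (H.vectorField_eq ▸ hx))
    have hbc : b ∈ critCells h.vectorField := H.vectorField_eq ▸ hb.birth_mem_critCells hbx
    have hbt := hbx.trans hxt
    rw [H.vectorField_eq, morseSum_congr (A := {z | g z < g b}) (B := {z | g z < g x})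
      (fun z hz => H.lt_iff_left hbc hsb hbt hz)
      (fun z hz => H.lt_iff_left hx hsx hxt hz)] at hmem
    refine ⟨b, hbc, hsb, hbx.le, fun p h1 h2 => mem_deathForbidden_of_not_mem hst ?_ hmem h1 h2⟩
    rw [← H.eq_of_between hbc hsb hbt]
    exact H.birth_le.trans_lt hsb

/-- An obstruction to moving the birth above `y` comes from the forbidden region of `h`. -/
theorem birth_blocked (H : Contracts h g s t) (hst : h.IsPair s t) {y : X}
    (hy : y ∈ critCells h.vectorField) (hsy : g s < g y) (hyt : g y < g t)
    (hbl : HasPath K g.vectorField y s ∨ ∃ d, g.IsPair y d ∧ g d < g t ∧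
      (fun i => K.dual.bd i s) ∉ morseSum K.dual g.dual.vectorField
        {z | g.dual z < g.dual d} {z | g.dual z < g.dual y}) :
    ∃ w ∈ critCells h.vectorField, g w < g t ∧ g y ≤ g w ∧
      ∀ p : EReal × EReal, (h y : EReal) ≤ p.1 → (h w : EReal) ≤ p.2 →
        p ∈ h.birthForbidden (s, t) := by
  rcases hbl with hp | ⟨d, hd, hdt, hmem⟩
  · rw [H.vectorField_eq] at hp
    exact ⟨y, hy, hyt, le_rfl, fun p h1 h2 => mem_birthForbidden_of_path hy hp h1 h2⟩
  · have hyd := hd.lt_of_mem_critCells (Or.inl (H.vectorField_eq ▸ hy))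
    have hdc : d ∈ critCells h.vectorField := H.vectorField_eq ▸ hd.death_mem_critCells hyd
    have hsd := hsy.trans hyd
    have hV : g.dual.vectorField = h.dual.vectorField := by
      rw [dual_vectorField, dual_vectorField, H.vectorField_eq]
    rw [hV, morseSum_congr (A := {z | g.dual z < g.dual d}) (A' := {z | h.dual z < -h d})
      (B := {z | g.dual z < g.dual y}) (B' := {z | h.dual z < -h y})
      (fun z hz => neg_lt_neg_iff.trans ((H.lt_iff_right hdc hsd hdt
        (h.dual_vectorField ▸ hz)).trans neg_lt_neg_iff.symm))
      (fun z hz => neg_lt_neg_iff.trans ((H.lt_iff_right hy hsy hyt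
        (h.dual_vectorField ▸ hz)).trans neg_lt_neg_iff.symm))] at hmem
    refine ⟨d, hdc, hdt, hyd.le, fun p h1 h2 => mem_birthForbidden_of_not_mem hst ?_ hmem h1 h2⟩
    rw [← H.eq_of_between hdc hsd hdt]
    exact hdt.trans_le H.le_death

/-- The critical cells between the components of the pair. -/
def between (g : DiscreteMorseFunction K) (s t : X) : Set X :=
  {z | z ∈ critCells g.vectorField ∧ g s < g z ∧ g z < g t}

theorem exists_step (H : Contracts h g s t) (hst : h.IsPair s t)
    (hdisj : h.birthForbidden (s, t) ∩ h.deathForbidden (s, t) = ∅)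
    (hne : (between g s t).Nonempty) :
    ∃ g', g.IsAllowedMove (s, t) g' ∧ Contracts h g' s t ∧
      (between g' s t).ncard < (between g s t).ncard := by
  have hst' := H.isPair.2 hst
  have hVe := H.vectorField_eq
  obtain ⟨x, ⟨hx, hsx, hxt⟩, hmax⟩ :=
    (Set.toFinite (between g s t)).exists_maximalFor g.toFun _ hne
  obtain ⟨y, ⟨hy, hsy, hyt⟩, hmin⟩ :=
    (Set.toFinite (between g s t)).exists_minimalFor g.toFun _ hne
  have hmax' : ∀ z ∈ critCells g.vectorField, g z < g t → g z ≤ g x := fun z hz h1 => by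
    by_contra hlt
    exact hlt (hmax (j := z) ⟨hz, hsx.trans (not_le.1 hlt), h1⟩ (not_le.1 hlt).le)
  have hmin' : ∀ z ∈ critCells g.vectorField, g s < g z → g y ≤ g z := fun z hz h1 => by
    by_contra hlt
    exact hlt (hmin (j := z) ⟨hz, h1, (not_le.1 hlt).trans hyt⟩ (not_le.1 hlt).le)
  have hx' : x ∈ critCells h.vectorField := hVe ▸ hx
  have hy' : y ∈ critCells h.vectorField := hVe ▸ hy
  by_cases hbd : HasPath K g.vectorField t x ∨ ∃ b, g.IsPair b x ∧ g s < g b ∧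
      (fun i => K.bd i t) ∉ morseSum K g.vectorField {z | g z < g b} {z | g z < g x}
  · by_cases hbb : HasPath K g.vectorField y s ∨ ∃ d, g.IsPair y d ∧ g d < g t ∧
      (fun i => K.dual.bd i s) ∉ morseSum K.dual g.dual.vectorField
        {z | g.dual z < g.dual d} {z | g.dual z < g.dual y}
    · exfalso
      obtain ⟨w, hw, hsw, hwx, hw'⟩ := H.death_blocked hst hx' hsx hxt hbd
      obtain ⟨u, hu, hut, hyu, hu'⟩ := H.birth_blocked hst hy' hsy hyt hbb
      have h1 : h y ≤ h w := by
        rw [← H.eq_of_between hy' hsy hyt, ← H.eq_of_between hw hsw (hwx.trans_lt hxt)]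
        exact hmin' w (hVe ▸ hw) hsw
      have h2 : h u ≤ h x := by
        rw [← H.eq_of_between hx' hsx hxt, ← H.eq_of_between hu (hsy.trans_le hyu) hut]
        exact hmax' u (hVe ▸ hu) hut
      -- The corner of the death quadrant dominates the corner (h y, h u) of the birth quadrant.
      have h3 : ((h w : EReal), (h x : EReal)) ∈
          h.birthForbidden (s, t) ∩ h.deathForbidden (s, t) :=
        ⟨hu' _ (EReal.coe_le_coe_iff.2 h1) (EReal.coe_le_coe_iff.2 h2), hw' _ le_rfl le_rfl⟩
      rw [hdisj] at h3
      exact h3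
    · push Not at hbb
      obtain ⟨g', hmove, hlt, hyg, heq⟩ := exists_birth_swap hst' hy hsy hyt hmin' hbb.1 hbb.2
      obtain ⟨⟨_, hpre⟩, hbde⟩ := id hmove
      have hV := hpre.vectorField_eq
      have htc := hst'.death_mem_critCells H.lt
      have ht := heq t htc hst'.ne.symm
      refine ⟨g', hmove, ⟨hV.symm.trans hVe, hbde.symm.trans H.birthDeath_eq,
        fun z hz hzs hzt => (heq z (hVe ▸ hz) hzs).trans (H.eq_of_ne z hz hzs hzt),
        H.birth_le.trans (hsy.trans hyg).le, ht ▸ H.le_death, ht ▸ hlt⟩,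
        Set.ncard_lt_ncard ((Set.ssubset_iff_of_subset ?_).2 ⟨y, ⟨hy, hsy, hyt⟩, ?_⟩)
        (Set.toFinite _)⟩
      · rintro z ⟨hz, h1, h2⟩
        rw [← hV] at hz
        have hzs : z ≠ s := by rintro rfl; exact lt_irrefl _ h1
        rw [heq z hz hzs] at h1 h2
        exact ⟨hz, (hsy.trans hyg).trans h1, ht ▸ h2⟩
      · rintro ⟨-, h1, -⟩
        rw [heq y hy (by rintro rfl; exact lt_irrefl _ hsy)] at h1
        exact _root_.lt_asymm h1 hyg
  · push Not at hbd
    obtain ⟨g', hmove, hlt, hxg, heq⟩ := exists_death_swap hst' hx hsx hxt hmax' hbd.1 hbd.2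
    obtain ⟨⟨_, hpre⟩, hbde⟩ := id hmove
    have hV := hpre.vectorField_eq
    have hsc := hst'.birth_mem_critCells H.lt
    have hs := heq s hsc hst'.ne
    refine ⟨g', hmove, ⟨hV.symm.trans hVe, hbde.symm.trans H.birthDeath_eq,
      fun z hz hzs hzt => (heq z (hVe ▸ hz) hzt).trans (H.eq_of_ne z hz hzs hzt),
      hs ▸ H.birth_le, (hxg.trans hxt).le.trans H.le_death, hs ▸ hlt⟩,
      Set.ncard_lt_ncard ((Set.ssubset_iff_of_subset ?_).2 ⟨x, ⟨hx, hsx, hxt⟩, ?_⟩)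
      (Set.toFinite _)⟩
    · rintro z ⟨hz, h1, h2⟩
      rw [← hV] at hz
      have hzt : z ≠ t := by rintro rfl; exact lt_irrefl _ h2
      rw [heq z hz hzt] at h1 h2
      exact ⟨hz, hs ▸ h1, h2.trans (hxg.trans hxt)⟩
    · rintro ⟨-, -, h1⟩
      rw [heq x hx (by rintro rfl; exact lt_irrefl _ hxt)] at h1
      exact _root_.lt_asymm h1 hxg

/-- Each step removes a critical cell from between the components; when none is left, a single
shrinking move finishes. -/
theorem exists_close (hst : h.IsPair s t)
    (hdisj : h.birthForbidden (s, t) ∩ h.deathForbidden (s, t) = ∅) {ε : ℝ} (hε : 0 < ε)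
    (n : ℕ) : ∀ g, Contracts h g s t → (between g s t).ncard = n →
      ∃ g', Relation.ReflTransGen (fun g g' => g.IsAllowedMove (s, t) g') g g' ∧
        0 < g' t - g' s ∧ g' t - g' s < ε := by
  induction n using Nat.strong_induction_on with
  | _ n ih =>
  intro g H hn
  by_cases hne : (between g s t).Nonempty
  · obtain ⟨g', h1, h2, h3⟩ := H.exists_step hst hdisj hne
    obtain ⟨g'', h4, h5⟩ := ih _ (hn ▸ h3) g' h2 rfl
    exact ⟨g'', Relation.ReflTransGen.head h1 h4, h5⟩
  · obtain ⟨g', h1, h2⟩ := exists_shrink (H.isPair.2 hst) H.lt (fun z hz h1 => by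
      by_contra hlt
      exact hne ⟨z, hz, not_le.1 hlt, h1⟩) hε
    exact ⟨g', Relation.ReflTransGen.single h1, h2⟩

end Contracts

theorem exists_sequence_of_reflTransGen {α : X × X}
    (hr : Relation.ReflTransGen (fun g g' : DiscreteMorseFunction K => g.IsAllowedMove α g') h g) :
    ∃ (n : ℕ) (f : ℕ → DiscreteMorseFunction K), f 0 = h ∧ f n = g ∧
      ∀ i < n, (f i).IsAllowedMove α (f (i + 1)) := by
  induction hr using Relation.ReflTransGen.head_induction_on with
  | refl => exact ⟨0, fun _ => g, rfl, rfl, fun i hi => absurd hi (Nat.not_lt_zero i)⟩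
  | @head a b h1 _ ih =>
    obtain ⟨n, f, h2, h3, h4⟩ := ih
    refine ⟨n + 1, fun i => Nat.casesOn i a f, rfl, h3, fun i hi => ?_⟩
    cases i with
    | zero => simpa [h2] using h1
    | succ i => exact h4 i (by omega)

end DiscreteMorseFunction

theorem mainTheorem3 {X : Type*} [Fintype X] (K : LefschetzComplex X)
    (h : DiscreteMorseFunction K) (α : X × X) (hα : α ∈ h.offDiagonal)
    (hdisj : h.birthForbidden α ∩ h.deathForbidden α = ∅) :
    ∀ ε : ℝ, 0 < ε → ∃ (n : ℕ) (g : ℕ → DiscreteMorseFunction K),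
      g 0 = h ∧
      (∀ i < n, (g i).IsAllowedMove α (g (i + 1))) ∧
      (∀ i ≤ n, (g i).birthDeath = h.birthDeath ∧ (g i).vectorField = h.vectorField) ∧
      0 < g n α.2 - g n α.1 ∧ g n α.2 - g n α.1 < ε := by
  intro ε hε
  obtain ⟨s, t⟩ := α
  obtain ⟨hst, hlt⟩ := DiscreteMorseFunction.mem_offDiagonal.1 hα
  obtain ⟨g', hr, hpos, hclose⟩ := DiscreteMorseFunction.Contracts.exists_close hst hdisj hε _ h
    ⟨rfl, rfl, fun _ _ _ _ => rfl, le_rfl, le_rfl, hlt⟩ rfl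
  obtain ⟨n, f, h0, hn, hmove⟩ := DiscreteMorseFunction.exists_sequence_of_reflTransGen hr
  refine ⟨n, f, h0, hmove, fun i => ?_, by rwa [hn], by rwa [hn]⟩
  induction i with
  | zero => exact fun _ => h0 ▸ ⟨rfl, rfl⟩
  | succ i ih =>
    intro hi
    obtain ⟨h1, h2⟩ := ih (by omega)
    obtain ⟨⟨c, hc⟩, hb⟩ := hmove i (by omega)
    exact ⟨hb.symm.trans h1, hc.vectorField_eq.symm.trans h2⟩
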